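/- For $s,\delta\in\mathbb R$ let $\langle x\rangle=(1+|x|^2)^{1/2}$ and let $H^{s,\delta}(\mathbb R^n)=\langle x\rangle^{-\delta}H^s(\mathbb R^n)$ be the Hilbert space of all tempered distributions $u$ on $\mathbb R^n$ such that $\langle x\rangle^{\delta}u$ belongs to the $L^2$-based Sobolev space $H^s(\mathbb R^n)$, with the norm $\|u\|_{H^{s,\delta}}=\|\langle\xi\rangle^{s}\,\mathcal F(\langle x\rangle^{\delta}u)\|_{L^2(\mathbb R^n)}$, where $\mathcal Fv(\xi)=\int e^{-2\pi i x\cdot\xi}v(x)\,dx$ (other normalizations of $\mathcal F$ give equivalent norms). For Hilbert spaces $E,F$ and $0<p<\infty$, let $\mathfrak S_p$ be the class of all bounded linear operators $T:E\to F$ with $\sum_{j=0}^\infty\alpha_j(T)^p<\infty$, where $\alpha_j(T)=\inf\{\|T-G\|:\ G:E\to F\text{ bounded linear},\ \dim R(G)\le j\}$ is the $j$-th approximation number of $T$. Let $0<p<\infty$ and let $s,s',\delta,\delta'\in\mathbb R$ satisfy $\delta>\delta'+n/p$ and $s>s'+n/p$. Then $H^{s,\delta}(\mathbb R^n)\subset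 H^{s',\delta'}(\mathbb R^n)$, and the embedding $$\iota:H^{s,\delta}(\mathbb R^n)\hookrightarrow H^{s',\delta'}(\mathbb R^n)$$ is continuous and belongs to the Schatten class $\mathfrak S_p$. -/

import Mathlib

open MeasureTheory
open scoped SchwartzMap

noncomputable section

/-- The `j`-th approximation number
`α_j(T) = inf {‖T - G‖ : G bounded linear, dim R(G) ≤ j}` of a bounded operator. The dimension of
the range is the cardinal-valued rank, so operators of infinite rank do not compete. -/
def approxNumber {E F : Type*} [NormedAddCommGroup E] [NormedSpace ℂ E]
    [NormedAddCommGroup F] [NormedSpace ℂ F] (T : E →L[ℂ] F) (j : ℕ) : ℝ :=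
  sInf {r : ℝ | ∃ G : E →L[ℂ] F,
    LinearMap.rank (G : E →ₗ[ℂ] F) ≤ (j : Cardinal) ∧ r = ‖T - G‖}

/-- `T` belongs to the Schatten class `𝔖_p` (`0 < p < ∞`): its approximation numbers are
`p`-summable. -/
def MemSchatten {E F : Type*} [NormedAddCommGroup E] [InnerProductSpace ℂ E]
    [NormedAddCommGroup F] [InnerProductSpace ℂ F] (p : ℝ) (T : E →L[ℂ] F) : Prop :=
  Summable fun j : ℕ => approxNumber T j ^ p

/-- The function `⟨x⟩ ^ r = (1 + |x|²) ^ (r / 2)` on `ℝⁿ`. -/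
def bracketPow (n : ℕ) (r : ℝ) (x : EuclideanSpace ℝ (Fin n)) : ℂ :=
  (((1 + ‖x‖ ^ 2) ^ (r / 2) : ℝ) : ℂ)

/-- Multiplication of tempered distributions on `ℝⁿ` by `⟨x⟩ ^ r`. -/
def mulBracket (n : ℕ) (r : ℝ) :
    𝓢'(EuclideanSpace ℝ (Fin n), ℂ) →L[ℂ] 𝓢'(EuclideanSpace ℝ (Fin n), ℂ) :=
  TemperedDistribution.smulLeftCLM ℂ (bracketPow n r)

theorem bracketPow_hasTemperateGrowth (n : ℕ) (r : ℝ) :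
    (bracketPow n r).HasTemperateGrowth := by
  unfold bracketPow
  fun_prop

theorem mulBracket_mulBracket (n : ℕ) (r t : ℝ) (u : 𝓢'(EuclideanSpace ℝ (Fin n), ℂ)) :
    mulBracket n t (mulBracket n r u) = mulBracket n (r + t) u := by
  unfold mulBracket
  rw [TemperedDistribution.smulLeftCLM_smulLeftCLM_apply (bracketPow_hasTemperateGrowth n r)
    (bracketPow_hasTemperateGrowth n t)]
  congr 2
  ext x
  simp only [Pi.mul_apply, bracketPow]
  norm_cast
  rw [← Real.rpow_add (by positivity)]
  ring_nf

theorem mulBracket_zero (n : ℕ) (u : 𝓢'(EuclideanSpace ℝ (Fin n), ℂ)) :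
    mulBracket n 0 u = u := by
  have h : bracketPow n 0 = fun _ => (1 : ℂ) := by
    ext x
    simp [bracketPow]
  rw [mulBracket, h, TemperedDistribution.smulLeftCLM_const, one_smul]

/-- The weighted Sobolev space `⟨x⟩^{-δ} H^s(ℝⁿ)`, as a space of tempered distributions:
all `u` with `⟨x⟩^δ u ∈ H^s(ℝⁿ)`. -/
def weightedSobolevSubmodule (n : ℕ) (s δ : ℝ) :
    Submodule ℂ 𝓢'(EuclideanSpace ℝ (Fin n), ℂ) where
  carrier := {u | TemperedDistribution.MemSobolev s 2 (mulBracket n δ u)}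
  add_mem' {u v} hu hv := by
    simpa only [Set.mem_ofPred_eq, map_add] using hu.add hv
  zero_mem' := by
    simp
  smul_mem' c u hu := by
    simpa only [Set.mem_ofPred_eq, map_smul] using hu.smul c

/-- `u` lies in the space if and only if it is of the form `⟨x⟩^{-δ} v` with `v ∈ H^s(ℝⁿ)`. -/
theorem mem_weightedSobolevSubmodule_iff (n : ℕ) (s δ : ℝ)
    (u : 𝓢'(EuclideanSpace ℝ (Fin n), ℂ)) :
    u ∈ weightedSobolevSubmodule n s δ ↔
      ∃ v, TemperedDistribution.MemSobolev s 2 v ∧ u = mulBracket n (-δ) v := by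
  constructor
  · intro hu
    refine ⟨mulBracket n δ u, hu, ?_⟩
    rw [mulBracket_mulBracket, add_neg_cancel, mulBracket_zero]
  · rintro ⟨v, hv, rfl⟩
    change TemperedDistribution.MemSobolev s 2 (mulBracket n δ (mulBracket n (-δ) v))
    rwa [mulBracket_mulBracket, neg_add_cancel, mulBracket_zero]

/-- The space `H^{s,δ}(ℝⁿ) = ⟨x⟩^{-δ} H^s(ℝⁿ)`. It is a type of its own because it carries its
Hilbert space norm and not the topology induced from the tempered distributions. -/
def WeightedSobolev (n : ℕ) (s δ : ℝ) : Type :=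
  weightedSobolevSubmodule n s δ

namespace WeightedSobolev

variable {n : ℕ} {s δ : ℝ}

instance : AddCommGroup (WeightedSobolev n s δ) :=
  inferInstanceAs (AddCommGroup (weightedSobolevSubmodule n s δ))

instance : Module ℂ (WeightedSobolev n s δ) :=
  inferInstanceAs (Module ℂ (weightedSobolevSubmodule n s δ))

/-- The tempered distribution underlying an element of `H^{s,δ}(ℝⁿ)`. -/
def toDistribution : WeightedSobolev n s δ →ₗ[ℂ] 𝓢'(EuclideanSpace ℝ (Fin n), ℂ) :=
  (weightedSobolevSubmodule n s δ).subtype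

theorem toDistribution_injective :
    Function.Injective (toDistribution (n := n) (s := s) (δ := δ)) :=
  Subtype.val_injective

theorem toDistribution_mem (u : WeightedSobolev n s δ) :
    ∃ f : Lp ℂ 2 (volume : Measure (EuclideanSpace ℝ (Fin n))),
      TemperedDistribution.besselPotential (EuclideanSpace ℝ (Fin n)) ℂ s
        (mulBracket n δ u.toDistribution) = Lp.toTemperedDistribution f :=
  u.2

theorem coe_L2_injective :
    Function.Injective (Lp.toTemperedDistributionCLM ℂ
      (volume : Measure (EuclideanSpace ℝ (Fin n))) 2) :=
  LinearMap.ker_eq_bot.mp Lp.ker_toTemperedDistributionCLM_eq_bot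

/-- The map `u ↦ ⟨D⟩^s ⟨x⟩^δ u` from `H^{s,δ}(ℝⁿ)` to `L²(ℝⁿ)`, where `⟨D⟩^s` is the Fourier
multiplier with symbol `(1 + |ξ|²) ^ (s / 2)`, the Fourier transform being `𝓕 u (ξ) = ∫ exp(-2πi x·ξ) u(x) dx`; see
`toL2_spec`. -/
def toL2 : WeightedSobolev n s δ →ₗ[ℂ]
    Lp ℂ 2 (volume : Measure (EuclideanSpace ℝ (Fin n))) where
  toFun u := u.toDistribution_mem.choose
  map_add' u v := by
    apply coe_L2_injective
    have h₁ := u.toDistribution_mem.choose_spec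
    have h₂ := v.toDistribution_mem.choose_spec
    have h₃ := (u + v).toDistribution_mem.choose_spec
    refine h₃.symm.trans ?_
    rw [map_add, map_add, map_add, map_add]
    exact congrArg₂ (· + ·) h₁ h₂
  map_smul' c u := by
    apply coe_L2_injective
    have h₁ := u.toDistribution_mem.choose_spec
    have h₂ := (c • u).toDistribution_mem.choose_spec
    refine h₂.symm.trans ?_
    rw [map_smul, map_smul, map_smul, map_smul]
    exact congrArg (c • ·) h₁

theorem toL2_spec (u : WeightedSobolev n s δ) :
    TemperedDistribution.besselPotential (EuclideanSpace ℝ (Fin n)) ℂ s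
      (mulBracket n δ u.toDistribution) = Lp.toTemperedDistribution (toL2 u) :=
  u.toDistribution_mem.choose_spec

theorem toL2_injective : Function.Injective (toL2 (n := n) (s := s) (δ := δ)) := by
  intro u v h
  apply toDistribution_injective
  have h1 := toL2_spec u
  rw [h, ← toL2_spec v] at h1
  have h2 := congrArg
    (TemperedDistribution.besselPotential (EuclideanSpace ℝ (Fin n)) ℂ (-s)) h1
  simp only [TemperedDistribution.besselPotential_besselPotential_apply, add_neg_cancel,
    TemperedDistribution.besselPotential_zero, ContinuousLinearMap.id_apply] at h2
  have h3 := congrArg (mulBracket n (-δ)) h2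
  simpa only [mulBracket_mulBracket, add_neg_cancel, mulBracket_zero] using h3

theorem toL2_surjective : Function.Surjective (toL2 (n := n) (s := s) (δ := δ)) := by
  intro f
  have h : TemperedDistribution.besselPotential (EuclideanSpace ℝ (Fin n)) ℂ s
      (mulBracket n δ (mulBracket n (-δ)
        (TemperedDistribution.besselPotential (EuclideanSpace ℝ (Fin n)) ℂ (-s)
          (Lp.toTemperedDistribution f)))) = (Lp.toTemperedDistribution f) := by
    simp [mulBracket_mulBracket, mulBracket_zero]
  let u : WeightedSobolev n s δ := ⟨_, ⟨f, h⟩⟩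
  exact ⟨u, coe_L2_injective ((toL2_spec u).symm.trans h)⟩

/-- The norm `‖u‖ = ‖⟨D⟩^s ⟨x⟩^δ u‖` in `L²(ℝⁿ)`. -/
instance : NormedAddCommGroup (WeightedSobolev n s δ) :=
  NormedAddCommGroup.induced (WeightedSobolev n s δ)
    (Lp ℂ 2 (volume : Measure (EuclideanSpace ℝ (Fin n)))) toL2 toL2_injective

theorem norm_eq (u : WeightedSobolev n s δ) : ‖u‖ = ‖toL2 u‖ := rfl

instance : NormedSpace ℂ (WeightedSobolev n s δ) where
  norm_smul_le c u := by
    rw [norm_eq, norm_eq, map_smul, norm_smul]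

instance : InnerProductSpace ℂ (WeightedSobolev n s δ) where
  inner u v := inner ℂ (toL2 u) (toL2 v)
  norm_sq_eq_re_inner u := by
    rw [norm_eq]
    exact norm_sq_eq_re_inner (𝕜 := ℂ) (toL2 u)
  conj_inner_symm u v := inner_conj_symm (toL2 u) (toL2 v)
  add_left u v w := by
    simp only [map_add, inner_add_left]
  smul_left u v c := by
    simp only [map_smul, inner_smul_left]

/-- `H^{s,δ}(ℝⁿ)` is isometrically isomorphic to `L²(ℝⁿ)`. -/
def toL2Isometry : WeightedSobolev n s δ ≃ₗᵢ[ℂ]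
    Lp ℂ 2 (volume : Measure (EuclideanSpace ℝ (Fin n))) where
  toLinearEquiv := LinearEquiv.ofBijective toL2 ⟨toL2_injective, toL2_surjective⟩
  norm_map' _ := rfl

/-- `H^{s,δ}(ℝⁿ)` is a Hilbert space. -/
instance : CompleteSpace (WeightedSobolev n s δ) :=
  (completeSpace_congr (e := toL2Isometry.toEquiv)
    toL2Isometry.isometry.isUniformEmbedding).mpr inferInstance

end WeightedSobolev

end

/-! Under the isometries of the weighted spaces with L², the embedding becomes A = ⟨D⟩^{s'}
⟨x⟩^{δ'-δ} ⟨D⟩^{-s}. A Gabor system almost diagonalizes it. On a Schwartz window shifted to position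
κ and frequency μ, the weights in x and D act as scalars ⟨κ⟩^r and ⟨μ⟩^r, up to a change of window
that stays in a bounded set of Schwartz functions (`besselWeight_atom`,
`isVonNBounded_shiftedWindow`; Peetre's inequality is the source of uniformity). Inserting this in
the reproducing formula `tsum_integral_atom_mul` gives A = ∑ l_i ⟨e_i, ·⟩ e'_i, where i = (κ, μ)
runs over ½ℤⁿ × ℤⁿ and l_i = ⟨κ⟩^{-(δ-δ')} ⟨μ⟩^{-(s-s')}.

The families e and e' are not orthonormal, but their Gram matrices decay rapidly off the diagonal,
so Schur's test makes them Bessel sequences (`exists_sum_norm_inner_atom_le`). Hence removing the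
terms with l_i > t leaves an operator of norm at most a constant times t, and the approximation
numbers are controlled by the decreasing rearrangement of l.

The strict hypotheses leave room for some q < p with (δ-δ')q > n and (s-s')q > n, so that ∑ l_i^q
converges. Chebyshev's inequality then gives α_j = O(j^{-1/q}), which is p-summable because p/q > 1
(`memSchatten_tsum_rankOneSMul`). -/

/-! ### Bessel sequences, rank one series and approximation numbers -/

section Bessel

variable {ι X Y : Type*} [NormedAddCommGroup X] [InnerProductSpace ℂ X]
  [NormedAddCommGroup Y] [InnerProductSpace ℂ Y]

/-- `e` is a Bessel sequence with bound `C`, expressed through its synthesis operator. -/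
def IsBesselSeq (e : ι → X) (C : ℝ) : Prop :=
  0 ≤ C ∧ ∀ (F : Finset ι) (a : ι → ℂ), ‖∑ i ∈ F, a i • e i‖ ^ 2 ≤ C * ∑ i ∈ F, ‖a i‖ ^ 2

/-- Schur's test for the Gram matrix. -/
theorem isBesselSeq_of_gram {e : ι → X} {C : ℝ} (hC : 0 ≤ C)
    (h : ∀ (i : ι) (F : Finset ι), ∑ j ∈ F, ‖inner ℂ (e i) (e j)‖ ≤ C) : IsBesselSeq e C := by
  refine ⟨hC, fun F a => ?_⟩
  have h1 : ‖∑ i ∈ F, a i • e i‖ ^ 2 ≤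
      ∑ i ∈ F, ∑ j ∈ F, ‖a i‖ * ‖a j‖ * ‖inner ℂ (e i) (e j)‖ := by
    rw [← inner_self_eq_norm_sq (𝕜 := ℂ), sum_inner]
    refine (RCLike.re_le_norm _).trans ((norm_sum_le _ _).trans (Finset.sum_le_sum fun i _ => ?_))
    rw [inner_sum]
    refine (norm_sum_le _ _).trans (Finset.sum_le_sum fun j _ => ?_)
    rw [inner_smul_left, inner_smul_right, norm_mul, norm_mul, RCLike.norm_conj, mul_assoc]
  have hsymm : ∀ i j, ‖inner ℂ (e i) (e j)‖ = ‖inner ℂ (e j) (e i)‖ := fun i j =>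
    norm_inner_symm _ _
  have h2 : ∑ i ∈ F, ∑ j ∈ F, ‖a i‖ ^ 2 * ‖inner ℂ (e i) (e j)‖ ≤ C * ∑ i ∈ F, ‖a i‖ ^ 2 := by
    rw [Finset.mul_sum]
    refine Finset.sum_le_sum fun i _ => ?_
    rw [← Finset.mul_sum, mul_comm]
    exact mul_le_mul_of_nonneg_right (h i F) (by positivity)
  have h3 : ∑ i ∈ F, ∑ j ∈ F, ‖a j‖ ^ 2 * ‖inner ℂ (e i) (e j)‖ ≤ C * ∑ i ∈ F, ‖a i‖ ^ 2 := by
    rw [Finset.sum_comm]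
    simpa only [hsymm] using h2
  have h4 : ∑ i ∈ F, ∑ j ∈ F, ‖a i‖ * ‖a j‖ * ‖inner ℂ (e i) (e j)‖ ≤
      ∑ i ∈ F, ∑ j ∈ F, (‖a i‖ ^ 2 * ‖inner ℂ (e i) (e j)‖ / 2 +
        ‖a j‖ ^ 2 * ‖inner ℂ (e i) (e j)‖ / 2) := by
    refine Finset.sum_le_sum fun i _ => Finset.sum_le_sum fun j _ => ?_
    nlinarith [mul_nonneg (sq_nonneg (‖a i‖ - ‖a j‖)) (norm_nonneg (inner ℂ (e i) (e j)))]
  simp only [Finset.sum_add_distrib, ← Finset.sum_div] at h4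
  linarith

/-- Analysis is adjoint to synthesis: with the coefficients ⟨e_i, f⟩ the left side S equals ⟨∑ ⟨e_i,
f⟩ e_i, f⟩, so Cauchy-Schwarz gives S² ≤ C S ‖f‖². -/
theorem IsBesselSeq.sum_inner_le {e : ι → X} {C : ℝ} (h : IsBesselSeq e C) (F : Finset ι)
    (f : X) : ∑ i ∈ F, ‖inner ℂ (e i) f‖ ^ 2 ≤ C * ‖f‖ ^ 2 := by
  set S := ∑ i ∈ F, ‖inner ℂ (e i) f‖ ^ 2 with hS
  have hS0 : 0 ≤ S := by positivity
  have h1 := h.2 F fun i => inner ℂ (e i) f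
  have h2 : inner ℂ (∑ i ∈ F, inner ℂ (e i) f • e i) f = (S : ℂ) := by
    rw [sum_inner, hS]
    push_cast
    refine Finset.sum_congr rfl fun i _ => ?_
    rw [inner_smul_left, RCLike.conj_mul]
    rfl
  have h3 : S ≤ ‖∑ i ∈ F, inner ℂ (e i) f • e i‖ * ‖f‖ := by
    have := norm_inner_le_norm (𝕜 := ℂ) (∑ i ∈ F, inner ℂ (e i) f • e i) f
    rwa [h2, Complex.norm_real, Real.norm_of_nonneg hS0] at this
  have h4 : S ^ 2 ≤ C * S * ‖f‖ ^ 2 := by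
    calc S ^ 2 ≤ (‖∑ i ∈ F, inner ℂ (e i) f • e i‖ * ‖f‖) ^ 2 := by gcongr
      _ = ‖∑ i ∈ F, inner ℂ (e i) f • e i‖ ^ 2 * ‖f‖ ^ 2 := by ring
      _ ≤ _ := by gcongr
  rcases hS0.eq_or_lt with h0 | h0
  · rw [← h0]
    exact mul_nonneg h.1 (sq_nonneg _)
  · nlinarith

/-- The rank one operator `f ↦ l ⟨x, f⟩ y`. -/
noncomputable def rankOneSMul (l : ℝ) (x : X) (y : Y) : X →L[ℂ] Y :=
  (l : ℂ) • (innerSL ℂ x).smulRight y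

theorem rankOneSMul_apply (l : ℝ) (x : X) (y : Y) (f : X) :
    rankOneSMul l x y f = ((l : ℂ) * inner ℂ x f) • y := by
  simp [rankOneSMul, mul_smul, Complex.coe_smul]

/-- The sum factors as analysis by e, a diagonal operator of norm at most t, and synthesis by e';
the outer factors have norms at most √C and √C'. -/
theorem norm_sum_rankOneSMul_le {e : ι → X} {e' : ι → Y} {C C' : ℝ} (h : IsBesselSeq e C)
    (h' : IsBesselSeq e' C') {l : ι → ℝ} (hl : ∀ i, 0 ≤ l i) {t : ℝ} (ht : 0 ≤ t)
    (F : Finset ι) (hF : ∀ i ∈ F, l i ≤ t) :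
    ‖∑ i ∈ F, rankOneSMul (l i) (e i) (e' i)‖ ≤ √(C * C') * t := by
  refine ContinuousLinearMap.opNorm_le_bound _ (by positivity) fun f => ?_
  have h1 := h'.2 F fun i => (l i : ℂ) * inner ℂ (e i) f
  have h2 : ∑ i ∈ F, ‖(l i : ℂ) * inner ℂ (e i) f‖ ^ 2 ≤ t ^ 2 * (C * ‖f‖ ^ 2) := by
    refine le_trans ?_ (mul_le_mul_of_nonneg_left (h.sum_inner_le F f) (sq_nonneg t))
    rw [Finset.mul_sum]
    refine Finset.sum_le_sum fun i hi => ?_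
    rw [norm_mul, mul_pow, Complex.norm_real, Real.norm_of_nonneg (hl i)]
    have := hF i hi
    have := hl i
    gcongr
  simp only [_root_.sum_apply, rankOneSMul_apply]
  refine abs_le_of_sq_le_sq' ?_ (by positivity) |>.2
  calc _ ≤ C' * (t ^ 2 * (C * ‖f‖ ^ 2)) := h1.trans (mul_le_mul_of_nonneg_left h2 h'.1)
    _ = (√(C * C') * t * ‖f‖) ^ 2 := by
      rw [mul_pow, mul_pow, Real.sq_sqrt (mul_nonneg h.1 h'.1)]
      ring

theorem summable_rankOneSMul [CompleteSpace Y] {e : ι → X} {e' : ι → Y} {C C' : ℝ}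
    (h : IsBesselSeq e C) (h' : IsBesselSeq e' C') {l : ι → ℝ} (hl : ∀ i, 0 ≤ l i)
    (hl0 : Filter.Tendsto l Filter.cofinite (nhds 0)) :
    Summable fun i => rankOneSMul (l i) (e i) (e' i) := by
  rw [summable_iff_vanishing_norm]
  intro ε hε
  set K := √(C * C') with hK
  have hK0 : 0 ≤ K := Real.sqrt_nonneg _
  -- K may vanish, hence K + 1.
  have ht : 0 < ε / (K + 1) := by positivity
  have hfin : {i | ¬ l i < ε / (K + 1)}.Finite := hl0.eventually (gt_mem_nhds ht)
  refine ⟨hfin.toFinset, fun F hF => ?_⟩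
  have := norm_sum_rankOneSMul_le h h' hl ht.le F fun i hi => by
    by_contra hc
    exact Finset.disjoint_left.mp hF hi (hfin.mem_toFinset.mpr fun h => hc h.le)
  refine this.trans_lt ?_
  rw [← hK, mul_div_assoc', div_lt_iff₀ (by positivity)]
  nlinarith

theorem rank_sum_rankOneSMul_le (l : ι → ℝ) (e : ι → X) (e' : ι → Y) (F : Finset ι) :
    LinearMap.rank ((∑ i ∈ F, rankOneSMul (l i) (e i) (e' i) : X →L[ℂ] Y) : X →ₗ[ℂ] Y) ≤
      (F.card : Cardinal) := by
  classical
  have h : LinearMap.range ((∑ i ∈ F, rankOneSMul (l i) (e i) (e' i) : X →L[ℂ] Y) : X →ₗ[ℂ] Y) ≤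
      Submodule.span ℂ (F.image e' : Set Y) := by
    rintro _ ⟨f, rfl⟩
    simp only [ContinuousLinearMap.coe_coe, _root_.sum_apply, rankOneSMul_apply]
    exact Submodule.sum_mem _ fun i hi =>
      Submodule.smul_mem _ _ (Submodule.subset_span
        (Finset.mem_coe.mpr (Finset.mem_image_of_mem e' hi)))
  exact (Submodule.rank_mono h).trans
    ((rank_span_finset_le _).trans (Nat.cast_le.mpr Finset.card_image_le))

theorem approxNumber_nonneg (T : X →L[ℂ] Y) (j : ℕ) : 0 ≤ approxNumber T j := by
  refine Real.sInf_nonneg ?_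
  rintro _ ⟨G, -, rfl⟩
  exact norm_nonneg _

theorem approxNumber_le (T G : X →L[ℂ] Y) (j : ℕ)
    (hG : LinearMap.rank (G : X →ₗ[ℂ] Y) ≤ (j : Cardinal)) : approxNumber T j ≤ ‖T - G‖ := by
  refine csInf_le ⟨0, ?_⟩ ⟨G, hG, rfl⟩
  rintro _ ⟨G, -, rfl⟩
  exact norm_nonneg _

/-- The finite-sum bound does not see the number of terms, so it passes to the limit over finite
sets containing F. -/
theorem norm_tsum_sub_sum_rankOneSMul_le [CompleteSpace Y] {e : ι → X} {e' : ι → Y} {C C' : ℝ}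
    (h : IsBesselSeq e C) (h' : IsBesselSeq e' C') {l : ι → ℝ} (hl : ∀ i, 0 ≤ l i)
    (hl0 : Filter.Tendsto l Filter.cofinite (nhds 0)) {t : ℝ} (ht : 0 ≤ t) (F : Finset ι)
    (hF : ∀ i ∉ F, l i ≤ t) :
    ‖∑' i, rankOneSMul (l i) (e i) (e' i) - ∑ i ∈ F, rankOneSMul (l i) (e i) (e' i)‖ ≤
      √(C * C') * t := by
  classical
  have hs := (summable_rankOneSMul h h' hl hl0).hasSum
  have hlim := (hs.sub_const (∑ i ∈ F, rankOneSMul (l i) (e i) (e' i))).norm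
  refine le_of_tendsto hlim ((Filter.eventually_ge_atTop F).mono fun G hG => ?_)
  rw [← Finset.sum_sdiff hG, add_sub_cancel_right]
  exact norm_sum_rankOneSMul_le h h' hl ht _ fun i hi => hF i (Finset.mem_sdiff.mp hi).2

theorem memSchatten_tsum_rankOneSMul [CompleteSpace Y] {e : ι → X} {e' : ι → Y} {C C' : ℝ}
    (h : IsBesselSeq e C) (h' : IsBesselSeq e' C') {l : ι → ℝ} (hl : ∀ i, 0 ≤ l i)
    {p q : ℝ} (hq : 0 < q) (hqp : q < p) (hsum : Summable fun i => l i ^ q)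
    (hl0 : Filter.Tendsto l Filter.cofinite (nhds 0)) :
    MemSchatten p (∑' i, rankOneSMul (l i) (e i) (e' i)) := by
  set A := ∑' i, rankOneSMul (l i) (e i) (e' i) with hA
  set M := ∑' i, l i ^ q with hM
  have hp : 0 < p := hq.trans hqp
  have hM0 : 0 ≤ M := tsum_nonneg fun i => Real.rpow_nonneg (hl i) q
  have key : ∀ j : ℕ, 0 < j → approxNumber A j ≤ √(C * C') * (M / j) ^ (1 / q) := by
    intro j hj
    have hj' : (0 : ℝ) < j := Nat.cast_pos.mpr hj
    -- If M = 0 the threshold is 0 and convergence to 0 says nothing about this set, but then all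
    -- l_i vanish.
    have hfin : {i | ¬ l i ≤ (M / j) ^ (1 / q)}.Finite := by
      rcases hM0.eq_or_lt with h0 | h0
      · convert Set.finite_empty
        ext i
        have hi : l i ^ q ≤ 0 := by
          rw [h0]
          exact hsum.le_tsum i fun k _ => Real.rpow_nonneg (hl k) q
        have : l i = 0 := by
          by_contra hne
          exact absurd hi (not_le.mpr (Real.rpow_pos_of_pos ((hl i).lt_of_ne' hne) q))
        simp [this]
        positivity
      · exact (hl0.eventually (gt_mem_nhds (show 0 < (M / j) ^ (1 / q) by positivity))).subset
          fun i hi hlt => hi hlt.le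
    set F := hfin.toFinset with hF
    -- Chebyshev: more than j indices with l_i^q > M / j would contribute more than M.
    have hcard : F.card ≤ j := by
      by_contra hc
      push Not at hc
      have hne : F.Nonempty := Finset.card_pos.mp (hj.trans hc)
      have hlt : ∀ i ∈ F, M / j < l i ^ q := by
        intro i hi
        have hi' : (M / j) ^ (1 / q) < l i := not_le.mp (hfin.mem_toFinset.mp hi)
        have := Real.rpow_lt_rpow (by positivity) hi' hq
        rwa [← Real.rpow_mul (by positivity), one_div_mul_cancel hq.ne', Real.rpow_one] at this
      have h1 : F.card • (M / j) < ∑ i ∈ F, l i ^ q := by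
        rw [← Finset.sum_const]
        exact Finset.sum_lt_sum_of_nonempty hne hlt
      have h2 : ∑ i ∈ F, l i ^ q ≤ M :=
        hsum.sum_le_tsum F fun i _ => Real.rpow_nonneg (hl i) q
      have h3 : M ≤ F.card • (M / j) := by
        rw [nsmul_eq_mul]
        calc M = j * (M / j) := by field_simp
          _ ≤ _ := by gcongr
      linarith
    refine (approxNumber_le A _ j ((rank_sum_rankOneSMul_le l e e' F).trans
      (Nat.cast_le.mpr hcard))).trans ?_
    refine norm_tsum_sub_sum_rankOneSMul_le h h' hl hl0 (by positivity) F fun i hi => ?_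
    by_contra hc
    exact hi (hfin.mem_toFinset.mpr hc)
  have hs : Summable fun j : ℕ => (√(C * C') * M ^ (1 / q)) ^ p * (1 / (j : ℝ) ^ (p / q)) :=
    (Real.summable_one_div_nat_rpow.mpr ((one_lt_div hq).mpr hqp)).mul_left _
  refine Summable.of_norm_bounded_eventually_nat hs ?_
  filter_upwards [Filter.eventually_gt_atTop 0] with j hj
  have hj' : (0 : ℝ) < j := Nat.cast_pos.mpr hj
  rw [Real.norm_of_nonneg (Real.rpow_nonneg (approxNumber_nonneg A j) p)]
  refine (Real.rpow_le_rpow (approxNumber_nonneg A j) (key j hj) hp.le).trans_eq ?_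
  rw [Real.div_rpow hM0 hj'.le, mul_div_assoc', Real.div_rpow (by positivity) (by positivity),
    ← Real.rpow_mul hj'.le, one_div_mul_eq_div, mul_one_div]

/-- If G competes for T, then V G U competes for V T U with no larger error. -/
theorem MemSchatten.comp_isometry {X' Y' : Type*} [NormedAddCommGroup X']
    [InnerProductSpace ℂ X'] [NormedAddCommGroup Y'] [InnerProductSpace ℂ Y'] {p : ℝ} (hp : 0 ≤ p)
    {T : X →L[ℂ] Y} (hT : MemSchatten p T) (U : X' ≃ₗᵢ[ℂ] X) (V : Y ≃ₗᵢ[ℂ] Y') :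
    MemSchatten p ((V : Y →L[ℂ] Y') ∘L T ∘L (U : X' →L[ℂ] X)) := by
  refine Summable.of_nonneg_of_le (fun j => Real.rpow_nonneg (approxNumber_nonneg _ j) p)
    (fun j => Real.rpow_le_rpow (approxNumber_nonneg _ j) ?_ hp) hT
  refine le_csInf ⟨_, 0, by simp, rfl⟩ ?_
  rintro _ ⟨G, hG, rfl⟩
  refine (approxNumber_le _ ((V : Y →L[ℂ] Y') ∘L G ∘L (U : X' →L[ℂ] X)) j ?_).trans ?_
  -- `Y` and `Y'` may live in different universes; a bound by a natural number survives the cardinal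
  -- lifts.
  · have h1 := LinearMap.rank_comp_le_left (U : X' →L[ℂ] X).toLinearMap (G : X →ₗ[ℂ] Y)
    have h2 := LinearMap.lift_rank_comp_le_right
      ((G : X →ₗ[ℂ] Y) ∘ₗ (U : X' →L[ℂ] X).toLinearMap) (V : Y →L[ℂ] Y').toLinearMap
    have h3 : Cardinal.lift.{_, _} (LinearMap.rank
      ((G : X →ₗ[ℂ] Y) ∘ₗ (U : X' →L[ℂ] X).toLinearMap)) ≤ _ := Cardinal.lift_le.mpr (h1.trans hG)
    have h4 := h2.trans h3
    rw [Cardinal.lift_natCast, Cardinal.lift_le_nat_iff] at h4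
    exact h4
  · refine ContinuousLinearMap.opNorm_le_bound _ (norm_nonneg _) fun x => ?_
    have := (T - G).le_opNorm (U x)
    rw [U.norm_map] at this
    simpa [← map_sub] using this

end Bessel

/-! ### Derivatives of ⟨x⟩^r and Peetre's inequality -/

section Symbols

open scoped ContDiff

theorem ContinuousLinearMap.norm_iteratedFDeriv_le_one_add {V W : Type*} [NormedAddCommGroup V]
    [NormedSpace ℝ V] [NormedAddCommGroup W] [NormedSpace ℝ W] (L : V →L[ℝ] W) (j : ℕ) (x : V) :
    ‖iteratedFDeriv ℝ j L x‖ ≤ ‖L‖ * (1 + ‖x‖) := by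
  have hx := norm_nonneg x
  have hL := norm_nonneg L
  rcases j with _ | j
  · rw [norm_iteratedFDeriv_zero]
    nlinarith [L.le_opNorm x]
  · have h : fderiv ℝ (L : V → W) = fun _ => L := by
      ext1 v
      exact L.fderiv
    rw [← norm_iteratedFDeriv_fderiv, h]
    rcases j with _ | j
    · rw [norm_iteratedFDeriv_zero]
      nlinarith
    · rw [iteratedFDeriv_succ_const]
      simp only [Pi.zero_apply, norm_zero]
      positivity

variable {V : Type*} [NormedAddCommGroup V] [InnerProductSpace ℝ V]

theorem fderiv_one_add_norm_sq_rpow (r : ℝ) :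
    fderiv ℝ (fun y : V => (1 + ‖y‖ ^ 2) ^ (r / 2)) =
      fun x => (1 + ‖x‖ ^ 2) ^ ((r - 2) / 2) • (r • innerSL ℝ : V →L[ℝ] V →L[ℝ] ℝ) x := by
  ext1 x
  have h1 : HasFDerivAt (fun y : V => 1 + ‖y‖ ^ 2) (2 • innerSL ℝ x) x := by
    simpa using (hasFDerivAt_id x).norm_sq.const_add 1
  have h2 := (h1.rpow_const (p := r / 2) (Or.inl (by positivity))).fderiv
  rw [h2]
  ext y
  have : r / 2 - 1 = (r - 2) / 2 := by ring
  simp [this]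
  ring

/-- Strong induction on the order, for all r at once: the gradient is r ⟨x⟩^{r-2} x, and Leibniz
calls the estimate with r - 2. The linear factor is bounded by 2⟨x⟩², which restores ⟨x⟩^r; the gain
of decay under differentiation is given up since it is not needed. -/
theorem norm_iteratedFDeriv_one_add_norm_sq_rpow_le (i : ℕ) : ∀ r : ℝ, ∃ C : ℝ, 0 ≤ C ∧
    ∀ x : V, ‖iteratedFDeriv ℝ i (fun y : V => (1 + ‖y‖ ^ 2) ^ (r / 2)) x‖ ≤
      C * (1 + ‖x‖ ^ 2) ^ (r / 2) := by
  induction i using Nat.strong_induction_on with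
  | _ i ih =>
  intro r
  rcases i with _ | i
  · refine ⟨1, zero_le_one, fun x => ?_⟩
    rw [norm_iteratedFDeriv_zero, one_mul, Real.norm_of_nonneg (by positivity)]
  -- The condition j ≤ i sits inside the existential so that the constants form a function on all of
  -- ℕ.
  have ih' : ∀ j : ℕ, ∃ C : ℝ, 0 ≤ C ∧ (j ≤ i → ∀ x : V,
      ‖iteratedFDeriv ℝ j (fun y : V => (1 + ‖y‖ ^ 2) ^ ((r - 2) / 2)) x‖ ≤
      C * (1 + ‖x‖ ^ 2) ^ ((r - 2) / 2)) := by
    intro j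
    by_cases hj : j ≤ i
    · obtain ⟨C, hC, h⟩ := ih j (Nat.lt_succ_of_le hj) (r - 2)
      exact ⟨C, hC, fun _ => h⟩
    · exact ⟨0, le_rfl, fun h => absurd h hj⟩
  choose C hC hCb using ih'
  set L : V →L[ℝ] V →L[ℝ] ℝ := r • innerSL ℝ with hL
  refine ⟨∑ j ∈ Finset.range (i + 1), (i.choose j : ℝ) * C j * ‖L‖ * 2, ?_, fun x => ?_⟩
  · exact Finset.sum_nonneg fun j _ => by have := hC j; positivity
  rw [← norm_iteratedFDeriv_fderiv, fderiv_one_add_norm_sq_rpow, Finset.sum_mul]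
  have hsm : ContDiff ℝ ∞ (fun y : V => (1 + ‖y‖ ^ 2) ^ ((r - 2) / 2)) :=
    (Function.hasTemperateGrowth_one_add_norm_sq_rpow V ((r - 2) / 2)).1
  refine (norm_iteratedFDeriv_smul_le hsm L.contDiff x (n := i) (by exact_mod_cast le_top)).trans
    (Finset.sum_le_sum fun j hj => ?_)
  have hj' : j ≤ i := Nat.lt_succ_iff.mp (Finset.mem_range.mp hj)
  have h1 := hCb j hj' x
  have h2 := L.norm_iteratedFDeriv_le_one_add (i - j) x
  have h3 : (1 + ‖x‖ ^ 2) ^ (r / 2) = (1 + ‖x‖ ^ 2) ^ ((r - 2) / 2) * (1 + ‖x‖ ^ 2) := by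
    rw [← Real.rpow_add_one (by positivity)]
    ring_nf
  have h4 : 1 + ‖x‖ ≤ 2 * (1 + ‖x‖ ^ 2) := by nlinarith [sq_nonneg (‖x‖ - 1)]
  have := hC j
  calc _ ≤ (i.choose j : ℝ) * (C j * (1 + ‖x‖ ^ 2) ^ ((r - 2) / 2)) * (‖L‖ * (1 + ‖x‖)) := by
        gcongr
    _ ≤ (i.choose j : ℝ) * (C j * (1 + ‖x‖ ^ 2) ^ ((r - 2) / 2)) *
          (‖L‖ * (2 * (1 + ‖x‖ ^ 2))) := by gcongr
    _ = _ := by rw [h3]; ring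

theorem one_add_norm_add_sq_le {W : Type*} [SeminormedAddCommGroup W] (x y : W) :
    1 + ‖x + y‖ ^ 2 ≤ 2 * (1 + ‖x‖ ^ 2) * (1 + ‖y‖ ^ 2) := by
  have h := norm_add_le x y
  have h2 : ‖x + y‖ ^ 2 ≤ (‖x‖ + ‖y‖) ^ 2 := by gcongr
  nlinarith [sq_nonneg (‖x‖ - ‖y‖), mul_nonneg (sq_nonneg ‖x‖) (sq_nonneg ‖y‖)]

/-- Peetre's inequality. -/
theorem one_add_norm_add_sq_rpow_le {W : Type*} [SeminormedAddCommGroup W] (r : ℝ) (x y : W) :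
    (1 + ‖x + y‖ ^ 2) ^ (r / 2) * (1 + ‖y‖ ^ 2) ^ (-r / 2) ≤
      (2 * (1 + ‖x‖ ^ 2)) ^ (|r| / 2) := by
  have hy : 0 < 1 + ‖y‖ ^ 2 := by positivity
  have hxy : 0 < 1 + ‖x + y‖ ^ 2 := by positivity
  rcases le_total 0 r with hr | hr
  · rw [abs_of_nonneg hr, neg_div, Real.rpow_neg hy.le, ← div_eq_mul_inv,
      ← Real.div_rpow hxy.le hy.le]
    refine Real.rpow_le_rpow (by positivity) ?_ (by positivity)
    rw [div_le_iff₀ hy]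
    exact one_add_norm_add_sq_le x y
  -- For r ≤ 0 the roles of y and x + y are exchanged, since y = -x + (x + y).
  · have h := one_add_norm_add_sq_le (-x) (x + y)
    rw [neg_add_cancel_left, norm_neg] at h
    have hr2 : r / 2 = -(|r| / 2) := by rw [abs_of_nonpos hr]; ring
    have hr3 : -r / 2 = |r| / 2 := by rw [abs_of_nonpos hr]
    rw [hr2, hr3, Real.rpow_neg hxy.le, mul_comm, ← div_eq_mul_inv, ← Real.div_rpow hy.le hxy.le]
    refine Real.rpow_le_rpow (by positivity) ?_ (by positivity)
    rwa [div_le_iff₀ hxy]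

end Symbols

/-! ### Uniform bounds for normalized translated weights -/

section ShiftWeight

variable {n : ℕ}

local notation "E" => EuclideanSpace ℝ (Fin n)

/-- The weight `x ↦ ⟨x + κ⟩ ^ r ⟨κ⟩ ^ (-r)`. -/
noncomputable def shiftWeight (n : ℕ) (r : ℝ) (κ x : EuclideanSpace ℝ (Fin n)) : ℂ :=
  bracketPow n (-r) κ * bracketPow n r (x + κ)

theorem shiftWeight_hasTemperateGrowth (r : ℝ) (κ : E) :
    (shiftWeight n r κ).HasTemperateGrowth := by
  have h : (fun x : E => bracketPow n r (x + κ)).HasTemperateGrowth :=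
    (bracketPow_hasTemperateGrowth n r).comp (g := bracketPow n r) (f := fun x : E => x + κ)
      (by fun_prop)
  exact (Function.HasTemperateGrowth.const _).mul h

/-- The symbol estimate at x + κ leaves ⟨x + κ⟩^r ⟨κ⟩^{-r}, from which Peetre's inequality removes
κ. The power is rounded up to an integer to match the Schwartz seminorms. -/
theorem norm_iteratedFDeriv_shiftWeight_le (r : ℝ) (i : ℕ) : ∃ C : ℝ, 0 ≤ C ∧ ∀ κ x : E,
    ‖iteratedFDeriv ℝ i (shiftWeight n r κ) x‖ ≤ C * (1 + ‖x‖) ^ ⌈|r|⌉₊ := by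
  obtain ⟨C, hC, h⟩ := norm_iteratedFDeriv_one_add_norm_sq_rpow_le (V := E) i r
  refine ⟨C * 2 ^ (|r| / 2), by positivity, fun κ x => ?_⟩
  set c : ℝ := (1 + ‖κ‖ ^ 2) ^ (-r / 2) with hc
  have hc0 : 0 ≤ c := by positivity
  set f : E → ℝ := fun y => (1 + ‖y‖ ^ 2) ^ (r / 2) with hf
  set L : ℝ →L[ℝ] ℂ := c • Complex.ofRealCLM with hL
  have hLn : ‖L‖ ≤ c := by
    rw [hL, norm_smul, Complex.ofRealCLM_norm, mul_one, Real.norm_of_nonneg hc0]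
  have he : shiftWeight n r κ = L ∘ fun y => f (y + κ) := by
    ext y
    simp [shiftWeight, bracketPow, hL, hf, hc]
  have hsm : ContDiff ℝ i (fun y => f (y + κ)) := by
    have : ContDiff ℝ i f :=
      (Function.hasTemperateGrowth_one_add_norm_sq_rpow E (r / 2)).1.of_le (by exact_mod_cast le_top)
    exact this.comp (contDiff_id.add contDiff_const)
  rw [he]
  refine (L.norm_iteratedFDeriv_comp_left hsm.contDiffAt le_rfl).trans ?_
  rw [iteratedFDeriv_comp_add_right]
  have hx : (1 + ‖x‖ ^ 2) ^ (|r| / 2) ≤ (1 + ‖x‖) ^ ⌈|r|⌉₊ := by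
    calc (1 + ‖x‖ ^ 2) ^ (|r| / 2) ≤ ((1 + ‖x‖) ^ 2) ^ (|r| / 2) := by
          refine Real.rpow_le_rpow (by positivity) ?_ (by positivity)
          nlinarith [norm_nonneg x]
      _ = (1 + ‖x‖) ^ |r| := by
          rw [← Real.rpow_natCast, ← Real.rpow_mul (by positivity)]
          congr 1
          push_cast
          ring
      _ ≤ (1 + ‖x‖) ^ (⌈|r|⌉₊ : ℝ) :=
          Real.rpow_le_rpow_of_exponent_le (by linarith [norm_nonneg x]) (Nat.le_ceil _)
      _ = _ := Real.rpow_natCast _ _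
  calc ‖L‖ * ‖iteratedFDeriv ℝ i f (x + κ)‖ ≤ c * (C * (1 + ‖x + κ‖ ^ 2) ^ (r / 2)) := by
        gcongr
        exact h _
    _ = C * ((1 + ‖x + κ‖ ^ 2) ^ (r / 2) * (1 + ‖κ‖ ^ 2) ^ (-r / 2)) := by rw [hc]; ring
    _ ≤ C * (2 * (1 + ‖x‖ ^ 2)) ^ (|r| / 2) := by
        gcongr
        exact one_add_norm_add_sq_rpow_le r x κ
    _ = C * 2 ^ (|r| / 2) * (1 + ‖x‖ ^ 2) ^ (|r| / 2) := by
        rw [Real.mul_rpow (by positivity) (by positivity)]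
        ring
    _ ≤ _ := by gcongr

/-- Multiplication by `⟨x + κ⟩ ^ r ⟨κ⟩ ^ (-r)` maps bounded sets of Schwartz functions to bounded
sets, uniformly in `κ`. -/
theorem isVonNBounded_smulLeftCLM_shiftWeight (r : ℝ) {S : Set 𝓢(E, ℂ)}
    (hS : Bornology.IsVonNBounded ℂ S) :
    Bornology.IsVonNBounded ℂ
      {ψ | ∃ κ : E, ∃ φ ∈ S, ψ = SchwartzMap.smulLeftCLM ℂ (shiftWeight n r κ) φ} := by
  rw [(schwartz_withSeminorms ℂ E ℂ).isVonNBounded_iff_seminorm_bounded]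
  rintro ⟨a, b⟩
  choose C hC hCb using norm_iteratedFDeriv_shiftWeight_le (n := n) r
  set M := ⌈|r|⌉₊
  obtain ⟨R, hR, hRS⟩ := (schwartz_withSeminorms ℂ E
    ℂ).isVonNBounded_iff_finset_seminorm_bounded.mp hS (Finset.Iic (a + M, b))
  -- Leibniz, with M extra powers of 1 + ‖x‖ charged to φ; the final 1 gives positivity and a strict
  -- bound.
  refine ⟨∑ j ∈ Finset.range (b + 1), (b.choose j : ℝ) * C j * (2 ^ (a + M) * R) + 1, ?_, ?_⟩
  · exact add_pos_of_nonneg_of_pos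
      (Finset.sum_nonneg fun j _ => by have := hC j; positivity) one_pos
  rintro _ ⟨κ, φ, hφ, rfl⟩
  refine lt_of_le_of_lt (SchwartzMap.seminorm_le_bound ℂ a b _
    (Finset.sum_nonneg fun j _ => by have := hC j; positivity) fun x => ?_) (lt_add_one _)
  have hρ := shiftWeight_hasTemperateGrowth (n := n) r κ
  have he : (SchwartzMap.smulLeftCLM ℂ (shiftWeight n r κ) φ : E → ℂ) =
      fun y => shiftWeight n r κ y * φ y := by
    ext y
    rw [SchwartzMap.smulLeftCLM_apply_apply hρ, smul_eq_mul]
  rw [he]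
  have h1 := norm_iteratedFDeriv_mul_le (n := b) hρ.1 (φ.smooth ⊤) x (by exact_mod_cast le_top)
  refine (mul_le_mul_of_nonneg_left h1 (by positivity)).trans ?_
  rw [Finset.mul_sum]
  refine Finset.sum_le_sum fun j hj => ?_
  have h2 := hCb j κ x
  have h3 := SchwartzMap.one_add_le_sup_seminorm_apply (𝕜 := ℂ) (m := (a + M, b)) (k := a + M)
    (n := b - j) le_rfl (Nat.sub_le _ _) φ x
  have h4 : ‖x‖ ^ a ≤ (1 + ‖x‖) ^ a := by
    gcongr
    linarith
  have h5 := (hRS φ hφ).le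
  have := hC j
  calc _ ≤ (1 + ‖x‖) ^ a * ((b.choose j : ℝ) * (C j * (1 + ‖x‖) ^ M) *
        ‖iteratedFDeriv ℝ (b - j) φ x‖) := by gcongr
    _ = (b.choose j : ℝ) * C j * ((1 + ‖x‖) ^ (a + M) * ‖iteratedFDeriv ℝ (b - j) φ x‖) := by
        rw [pow_add]; ring
    _ ≤ (b.choose j : ℝ) * C j * (2 ^ (a + M) * R) := by
        exact mul_le_mul_of_nonneg_left (h3.trans (mul_le_mul_of_nonneg_left h5 (by positivity)))
          (by positivity)

theorem exists_decay_of_isVonNBounded {S : Set 𝓢(E, ℂ)} (hS : Bornology.IsVonNBounded ℂ S)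
    (N : ℕ) : ∃ C : ℝ, 0 ≤ C ∧ ∀ φ ∈ S, ∀ x : E, (1 + ‖x‖) ^ N * ‖φ x‖ ≤ C := by
  obtain ⟨R, hR, hRS⟩ := (schwartz_withSeminorms ℂ E
    ℂ).isVonNBounded_iff_finset_seminorm_bounded.mp hS (Finset.Iic (N, 0))
  refine ⟨2 ^ N * R, by positivity, fun φ hφ x => ?_⟩
  have h := SchwartzMap.one_add_le_sup_seminorm_apply (𝕜 := ℂ) (m := (N, 0)) (k := N) (n := 0)
    le_rfl le_rfl φ x
  rw [norm_iteratedFDeriv_zero] at h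
  exact h.trans (mul_le_mul_of_nonneg_left (hRS φ hφ).le (by positivity))

end ShiftWeight

/-! ### Time-frequency shifts, their images under Bessel weights, and their Gram matrix -/

section Atoms

open FourierTransform

variable {n : ℕ}

local notation "E" => EuclideanSpace ℝ (Fin n)

theorem hasTemperateGrowth_exp_ofReal_mul_I :
    (fun t : ℝ => Complex.exp (t * Complex.I)).HasTemperateGrowth := by
  have h : ∀ i : ℕ, iteratedDeriv i (fun t : ℝ => Complex.exp (t * Complex.I)) =
      fun t : ℝ => Complex.I ^ i * Complex.exp (t * Complex.I) := by
    intro i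
    induction i with
    | zero => simp
    | succ i ih =>
      rw [iteratedDeriv_succ, ih]
      ext t
      have h1 : HasDerivAt (fun t : ℝ => (t : ℂ) * Complex.I) (1 * Complex.I) t :=
        (Complex.ofRealCLM.hasDerivAt (x := t)).mul_const Complex.I
      rw [(h1.cexp.const_mul (Complex.I ^ i)).deriv]
      ring
  refine ⟨(Complex.ofRealCLM.contDiff.mul contDiff_const).cexp, fun i => ⟨0, 1, fun t => ?_⟩⟩
  rw [norm_iteratedFDeriv_eq_norm_iteratedDeriv, h]
  simp [Complex.norm_exp_ofReal_mul_I]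

/-- The character `x ↦ exp (2πi μ·x)`. -/
noncomputable def modulation (μ x : EuclideanSpace ℝ (Fin n)) : ℂ :=
  Complex.exp ((2 * Real.pi * inner ℝ μ x : ℝ) * Complex.I)

theorem norm_modulation (μ x : E) : ‖modulation μ x‖ = 1 :=
  Complex.norm_exp_ofReal_mul_I _

theorem modulation_add_left (μ ν x : E) :
    modulation (μ + ν) x = modulation μ x * modulation ν x := by
  rw [modulation, modulation, modulation, ← Complex.exp_add, inner_add_left]
  push_cast
  ring_nf

theorem modulation_add_right (μ x y : E) :
    modulation μ (x + y) = modulation μ x * modulation μ y := by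
  rw [modulation, modulation, modulation, ← Complex.exp_add, inner_add_right]
  push_cast
  ring_nf

theorem modulation_comm (μ x : E) : modulation μ x = modulation x μ := by
  rw [modulation, modulation, real_inner_comm]

theorem modulation_hasTemperateGrowth (μ : E) : (modulation μ).HasTemperateGrowth := by
  have h : (fun x : E => 2 * Real.pi * inner ℝ μ x).HasTemperateGrowth := by fun_prop
  exact hasTemperateGrowth_exp_ofReal_mul_I.comp h

/-- The time-frequency shift `x ↦ exp (2πi μ·x) θ (x - κ)` of a Schwartz function. -/
noncomputable def atom (θ : 𝓢(E, ℂ)) (κ μ : E) : 𝓢(E, ℂ) :=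
  SchwartzMap.smulLeftCLM ℂ (modulation μ) (SchwartzMap.compSubConstCLM ℂ κ θ)

theorem atom_apply (θ : 𝓢(E, ℂ)) (κ μ x : E) :
    atom θ κ μ x = modulation μ x * θ (x - κ) := by
  rw [atom, SchwartzMap.smulLeftCLM_apply_apply (modulation_hasTemperateGrowth μ), smul_eq_mul,
    SchwartzMap.compSubConstCLM_apply]

theorem fourierInv_apply_eq_integral (θ : 𝓢(E, ℂ)) (ξ : E) :
    𝓕⁻ θ ξ = ∫ x, modulation ξ x * θ x := by
  rw [SchwartzMap.fourierInv_coe, Real.fourierInv_eq']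
  simp only [modulation, smul_eq_mul, real_inner_comm]

/-- Translate by κ and merge the characters. The inverse transform is concentrated near -μ, whence
the -μ in `shiftedWindow`. -/
theorem fourierInv_atom_apply (θ : 𝓢(E, ℂ)) (κ μ ξ : E) :
    𝓕⁻ (atom θ κ μ) ξ = modulation κ (ξ + μ) * 𝓕⁻ θ (ξ + μ) := by
  rw [fourierInv_apply_eq_integral, fourierInv_apply_eq_integral, ← integral_const_mul,
    ← integral_add_right_eq_self _ κ]
  refine integral_congr_ae (.of_forall fun x => ?_)
  simp only [atom_apply, add_sub_cancel_right, ← mul_assoc, ← modulation_add_left]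
  rw [add_comm x κ, modulation_add_right, modulation_comm]

/-- The transpose `φ ↦ 𝓕 (⟨·⟩^{-s} 𝓕⁻ (⟨·⟩^{-δ} φ))` of `⟨x⟩^{-δ} ⟨D⟩^{-s}`. -/
noncomputable def besselWeight (n : ℕ) (s δ : ℝ) (φ : 𝓢(EuclideanSpace ℝ (Fin n), ℂ)) :
    𝓢(EuclideanSpace ℝ (Fin n), ℂ) :=
  𝓕 (SchwartzMap.smulLeftCLM ℂ (bracketPow n (-s))
    (𝓕⁻ (SchwartzMap.smulLeftCLM ℂ (bracketPow n (-δ)) φ)))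

theorem bracketPow_mul_neg (r : ℝ) (x : E) : bracketPow n r x * bracketPow n (-r) x = 1 := by
  rw [bracketPow, bracketPow, ← Complex.ofReal_mul, ← Real.rpow_add (by positivity)]
  simp [neg_div]

theorem bracketPow_neg_arg (r : ℝ) (x : E) : bracketPow n r (-x) = bracketPow n r x := by
  rw [bracketPow, bracketPow, norm_neg]

/-- Write ⟨x⟩^r = ⟨κ⟩^r · (⟨κ⟩^{-r} ⟨x⟩^r); the bracket is `shiftWeight` at x - κ and is absorbed by
the window. -/
theorem smulLeftCLM_bracketPow_atom (r : ℝ) (θ : 𝓢(E, ℂ)) (κ μ : E) :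
    SchwartzMap.smulLeftCLM ℂ (bracketPow n r) (atom θ κ μ) =
      bracketPow n r κ • atom (SchwartzMap.smulLeftCLM ℂ (shiftWeight n r κ) θ) κ μ := by
  ext x
  rw [SchwartzMap.smulLeftCLM_apply_apply (bracketPow_hasTemperateGrowth n r),
    _root_.smul_apply, atom_apply, atom_apply,
    SchwartzMap.smulLeftCLM_apply_apply (shiftWeight_hasTemperateGrowth r κ)]
  simp only [smul_eq_mul, shiftWeight, sub_add_cancel]
  linear_combination (-(modulation μ x * bracketPow n r x * θ (x - κ))) * bracketPow_mul_neg r κ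

/-- The window obtained from `θ` after conjugating `besselWeight` by a time-frequency shift. -/
noncomputable def shiftedWindow (n : ℕ) (s δ : ℝ) (θ : 𝓢(EuclideanSpace ℝ (Fin n), ℂ))
    (κ μ : EuclideanSpace ℝ (Fin n)) : 𝓢(EuclideanSpace ℝ (Fin n), ℂ) :=
  𝓕 (SchwartzMap.smulLeftCLM ℂ (shiftWeight n (-s) (-μ))
    (𝓕⁻ (SchwartzMap.smulLeftCLM ℂ (shiftWeight n (-δ) κ) θ)))

/-- The weight extraction is used at κ in position, then at -μ on the Fourier side, where ⟨-μ⟩ =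
⟨μ⟩. Both sides are compared after applying the injective map 𝓕⁻. -/
theorem besselWeight_atom (s δ : ℝ) (θ : 𝓢(E, ℂ)) (κ μ : E) :
    besselWeight n s δ (atom θ κ μ) =
      (bracketPow n (-δ) κ * bracketPow n (-s) μ) • atom (shiftedWindow n s δ θ κ μ) κ μ := by
  refine (Function.LeftInverse.injective (g := fun ψ : 𝓢(E, ℂ) => 𝓕 ψ)
    fun ψ => FourierTransform.fourier_fourierInv_eq ψ : Function.Injective
      fun ψ : 𝓢(E, ℂ) => 𝓕⁻ ψ) ?_
  simp only [besselWeight, FourierTransform.fourierInv_smul,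
    FourierTransform.fourierInv_fourier_eq, smulLeftCLM_bracketPow_atom, map_smul]
  ext ξ
  simp only [_root_.smul_apply, fourierInv_atom_apply, shiftedWindow,
    FourierTransform.fourierInv_fourier_eq, smul_eq_mul,
    SchwartzMap.smulLeftCLM_apply_apply (bracketPow_hasTemperateGrowth n (-s)),
    SchwartzMap.smulLeftCLM_apply_apply (shiftWeight_hasTemperateGrowth (-s) (-μ))]
  simp only [shiftWeight, add_neg_cancel_right, bracketPow_neg_arg]
  generalize 𝓕⁻ (SchwartzMap.smulLeftCLM ℂ (shiftWeight n (-δ) κ) θ) (ξ + μ) = z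
  linear_combination (-(bracketPow n (-δ) κ * bracketPow n (-s) ξ * modulation κ (ξ + μ) * z)) *
    bracketPow_mul_neg (-s) μ

/-- The Fourier maps are continuous and both multiplications preserve boundedness uniformly in the
shift, so one bounded set serves all κ and μ. -/
theorem isVonNBounded_shiftedWindow (s δ : ℝ) (θ : 𝓢(E, ℂ)) :
    Bornology.IsVonNBounded ℂ {ψ | ∃ κ μ : E, ψ = shiftedWindow n s δ θ κ μ} := by
  have h1 := (isVonNBounded_smulLeftCLM_shiftWeight (n := n) (-δ)
    (Bornology.isVonNBounded_singleton (𝕜 := ℂ) θ)).image (FourierTransform.fourierInvCLM ℂ 𝓢(E, ℂ))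
  have h2 := (isVonNBounded_smulLeftCLM_shiftWeight (n := n) (-s) h1).image
    (FourierTransform.fourierCLM ℂ 𝓢(E, ℂ))
  refine h2.subset ?_
  rintro _ ⟨κ, μ, rfl⟩
  exact ⟨_, ⟨-μ, _, ⟨_, ⟨κ, θ, rfl, rfl⟩, rfl⟩, rfl⟩, rfl⟩

/-- From 1 + |a - b| ≤ (1 + |x - a|)(1 + |x - b|), N powers of each factor pay for the decay in a -
b; the n + 1 powers left at a make the integral converge, with K its value. -/
theorem exists_norm_integral_inner_le (N : ℕ) : ∃ K : ℝ, 0 ≤ K ∧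
    ∀ (a b : E) (φ ψ : E → ℂ) (C : ℝ), 0 ≤ C →
      (∀ x, (1 + ‖x - a‖) ^ (N + (n + 1)) * ‖φ x‖ ≤ C) →
      (∀ x, (1 + ‖x - b‖) ^ (N + (n + 1)) * ‖ψ x‖ ≤ C) →
      (1 + ‖a - b‖) ^ N * ‖∫ x, inner ℂ (φ x) (ψ x)‖ ≤ K * C ^ 2 := by
  set w : E → ℝ := fun x => (1 + ‖x‖) ^ (-((n + 1 : ℕ) : ℝ)) with hw
  have hwi : Integrable w := integrable_one_add_norm (by simp)
  refine ⟨∫ x, w x, integral_nonneg fun x => by positivity, fun a b φ ψ C hC hφ hψ => ?_⟩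
  have hab : 0 < (1 + ‖a - b‖) ^ N := by positivity
  have key : ∀ x, ‖inner ℂ (φ x) (ψ x)‖ ≤ C ^ 2 / (1 + ‖a - b‖) ^ N * w (x - a) := by
    intro x
    have h1 : 1 + ‖a - b‖ ≤ (1 + ‖x - a‖) * (1 + ‖x - b‖) := by
      have : ‖a - b‖ ≤ ‖x - a‖ + ‖x - b‖ := by
        rw [show a - b = (x - b) - (x - a) by abel, add_comm]
        exact norm_sub_le _ _
      nlinarith [mul_nonneg (norm_nonneg (x - a)) (norm_nonneg (x - b))]
    have h2 : (1 + ‖a - b‖) ^ N ≤ (1 + ‖x - a‖) ^ N * (1 + ‖x - b‖) ^ N := by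
      rw [← mul_pow]
      gcongr
    have hwx : w (x - a) * (1 + ‖x - a‖) ^ (n + 1) = 1 := by
      simp only [hw]
      rw [Real.rpow_neg (by positivity), Real.rpow_natCast]
      exact inv_mul_cancel₀ (by positivity)
    have hw0 : 0 ≤ w (x - a) := by positivity
    have h3 : (1 + ‖x - b‖) ^ N * ‖ψ x‖ ≤ C := by
      refine le_trans ?_ (hψ x)
      gcongr
      · linarith [norm_nonneg (x - b)]
      · omega
    have h4 : (1 + ‖a - b‖) ^ N * (‖φ x‖ * ‖ψ x‖) ≤ C ^ 2 * w (x - a) := by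
      calc _ ≤ ((1 + ‖x - a‖) ^ N * (1 + ‖x - b‖) ^ N) * (‖φ x‖ * ‖ψ x‖) := by gcongr
        _ = (w (x - a) * (1 + ‖x - a‖) ^ (n + 1)) *
            ((1 + ‖x - a‖) ^ N * (1 + ‖x - b‖) ^ N) * (‖φ x‖ * ‖ψ x‖) := by rw [hwx, one_mul]
        _ = w (x - a) * ((1 + ‖x - a‖) ^ (N + (n + 1)) * ‖φ x‖) *
            ((1 + ‖x - b‖) ^ N * ‖ψ x‖) := by rw [pow_add]; ring
        _ ≤ w (x - a) * C * C := by
            gcongr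
            exact hφ x
        _ = _ := by ring
    have h5 : ‖inner ℂ (φ x) (ψ x)‖ ≤ ‖φ x‖ * ‖ψ x‖ := norm_inner_le_norm _ _
    rw [div_mul_eq_mul_div, le_div_iff₀ hab]
    calc _ ≤ (1 + ‖a - b‖) ^ N * (‖φ x‖ * ‖ψ x‖) := by
          rw [mul_comm]
          gcongr
      _ ≤ _ := h4
  have h := norm_integral_le_of_norm_le ((hwi.comp_sub_right a).const_mul _) (.of_forall key)
  rw [integral_const_mul, integral_sub_right_eq_self w a, div_mul_eq_mul_div,
    le_div_iff₀ hab] at h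
  linarith

/-- Decay in κ - κ' comes from the decay of the windows, decay in μ - μ' from that of their inverse
transforms through Plancherel. Each is proved with exponent 2N, and AB ≤ (A² + B²)/2 combines them
into a product. -/
theorem exists_norm_inner_atom_le {S : Set 𝓢(E, ℂ)} (hS : Bornology.IsVonNBounded ℂ S) (N : ℕ) :
    ∃ C : ℝ, 0 ≤ C ∧ ∀ θ ∈ S, ∀ θ' ∈ S, ∀ κ μ κ' μ' : E,
      (1 + ‖κ - κ'‖) ^ N * (1 + ‖μ - μ'‖) ^ N *
        ‖inner ℂ ((atom θ κ μ).toLp 2 volume) ((atom θ' κ' μ').toLp 2 volume)‖ ≤ C := by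
  obtain ⟨K, hK, hKb⟩ := exists_norm_integral_inner_le (n := n) (2 * N)
  obtain ⟨C₁, hC₁, h₁⟩ := exists_decay_of_isVonNBounded hS (2 * N + (n + 1))
  obtain ⟨C₂, hC₂, h₂⟩ := exists_decay_of_isVonNBounded
    (hS.image (FourierTransform.fourierInvCLM ℂ 𝓢(E, ℂ))) (2 * N + (n + 1))
  refine ⟨K * C₁ ^ 2 + K * C₂ ^ 2, by positivity, fun θ hθ θ' hθ' κ μ κ' μ' => ?_⟩
  have hx : ∀ η ∈ S, ∀ a b x : E, (1 + ‖x - a‖) ^ (2 * N + (n + 1)) * ‖atom η a b x‖ ≤ C₁ := by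
    intro η hη a b x
    rw [atom_apply, norm_mul, norm_modulation, one_mul]
    exact h₁ η hη (x - a)
  have hξ : ∀ η ∈ S, ∀ a b ξ : E,
      (1 + ‖ξ - -b‖) ^ (2 * N + (n + 1)) * ‖𝓕⁻ (atom η a b) ξ‖ ≤ C₂ := by
    intro η hη a b ξ
    rw [fourierInv_atom_apply, norm_mul, norm_modulation, one_mul, sub_neg_eq_add]
    exact h₂ _ ⟨η, hη, rfl⟩ (ξ + b)
  have e₁ := hKb κ κ' _ _ C₁ hC₁ (hx θ hθ κ μ) (hx θ' hθ' κ' μ')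
  have e₂ := hKb (-μ) (-μ') _ _ C₂ hC₂ (hξ θ hθ κ μ) (hξ θ' hθ' κ' μ')
  rw [← SchwartzMap.integral_inner_fourier_fourier] at e₂
  simp only [FourierTransform.fourier_fourierInv_eq] at e₂
  rw [show -μ - -μ' = -(μ - μ') by abel, norm_neg] at e₂
  rw [SchwartzMap.inner_toL2_toL2_eq (atom θ κ μ) (atom θ' κ' μ') volume]
  set G := ‖∫ x, inner ℂ (atom θ κ μ x) (atom θ' κ' μ' x)‖
  have hG : 0 ≤ G := norm_nonneg _
  rw [mul_comm 2 N, pow_mul] at e₁ e₂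
  nlinarith [mul_nonneg (sq_nonneg ((1 + ‖κ - κ'‖) ^ N - (1 + ‖μ - μ'‖) ^ N)) hG,
    mul_nonneg (sq_nonneg ((1 + ‖κ - κ'‖) ^ N)) hG, mul_nonneg (sq_nonneg ((1 + ‖μ - μ'‖) ^ N)) hG]

end Atoms

/-! ### Lattice sums -/

section Lattice

/-- The point `t k` of the lattice `t ℤⁿ`. -/
noncomputable def latticePoint (n : ℕ) (t : ℝ) (k : Fin n → ℤ) : EuclideanSpace ℝ (Fin n) :=
  WithLp.toLp 2 fun i => t * k i

theorem latticePoint_sub (n : ℕ) (t : ℝ) (k l : Fin n → ℤ) :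
    latticePoint n t (k - l) = latticePoint n t k - latticePoint n t l := by
  ext i
  simp [latticePoint, mul_sub]

theorem summable_one_add_norm_latticePoint {n : ℕ} {t : ℝ} (ht : t ≠ 0) {r : ℝ} (hr : n < r) :
    Summable fun k : Fin n → ℤ => (1 + ‖latticePoint n t k‖) ^ (-r) := by
  set b := (EuclideanSpace.basisFun (Fin n) ℝ).toBasis with hb
  set L := Submodule.span ℤ (Set.range b) with hL
  have hfr : Module.finrank ℤ L = n := by
    rw [ZLattice.rank ℝ L]
    simp
  have hs := ZLattice.summable_norm_rpow L (-r) (by rw [hfr]; linarith)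
  have hmem : ∀ k : Fin n → ℤ, latticePoint n 1 k ∈ L := by
    intro k
    have : latticePoint n 1 k = ∑ i, k i • b i := by
      ext j
      simp [latticePoint, hb, Finset.sum_apply, Pi.single_apply]
    rw [this]
    exact Submodule.sum_mem _ fun i _ => Submodule.smul_mem _ _ (Submodule.subset_span ⟨i, rfl⟩)
  have hinj : Function.Injective fun k : Fin n → ℤ => (⟨latticePoint n 1 k, hmem k⟩ : L) := by
    intro k l h
    have h' := congrArg (fun z : L => (z : EuclideanSpace ℝ (Fin n))) h
    ext i
    have := congrArg (fun z : EuclideanSpace ℝ (Fin n) => z i) h'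
    simpa [latticePoint] using this
  have hs' := (hs.comp_injective hinj).mul_left (|t| ^ (-r))
  refine Summable.of_norm_bounded_eventually hs' ?_
  -- At k = 0 the comparison term is 0 ^ (-r) = 0 and the bound fails.
  have h0 : ∀ᶠ k : Fin n → ℤ in Filter.cofinite, k ≠ 0 := by
    simp [Filter.eventually_cofinite]
  filter_upwards [h0] with k hk
  have hsc : latticePoint n t k = t • latticePoint n 1 k := by
    ext i
    simp [latticePoint]
  have hne : 0 < ‖latticePoint n 1 k‖ := by
    rw [norm_pos_iff]
    intro h
    apply hk
    apply hinj
    simp only [h]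
    ext i
    simp [latticePoint]
  have hr0 : 0 < r := (Nat.cast_nonneg n).trans_lt hr
  rw [Real.norm_of_nonneg (by positivity)]
  simp only [Function.comp_apply, Submodule.coe_norm]
  have htp : 0 < |t| := abs_pos.mpr ht
  rw [← Real.mul_rpow (by positivity) (by positivity), hsc, norm_smul, Real.norm_eq_abs]
  exact Real.rpow_le_rpow_of_nonpos (by positivity) (by linarith) (by linarith)

end Lattice

/-! ### Schur's condition for lattice families of atoms -/

section AtomBessel

variable {n : ℕ}

/-- The Gram matrix of the time-frequency shifts of a bounded family of windows over a lattice
satisfies Schur's condition. -/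
theorem exists_sum_norm_inner_atom_le {S : Set 𝓢(EuclideanSpace ℝ (Fin n), ℂ)}
    (hS : Bornology.IsVonNBounded ℂ S) {t t' : ℝ} (ht : t ≠ 0) (ht' : t' ≠ 0) :
    ∃ C : ℝ, 0 ≤ C ∧ ∀ θ : (Fin n → ℤ) × (Fin n → ℤ) → 𝓢(EuclideanSpace ℝ (Fin n), ℂ), (∀ i, θ i ∈ S) →
      ∀ (i : (Fin n → ℤ) × (Fin n → ℤ)) (F : Finset ((Fin n → ℤ) × (Fin n → ℤ))),
        ∑ j ∈ F, ‖inner ℂ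
          ((atom (θ i) (latticePoint n t i.1) (latticePoint n t' i.2)).toLp 2 volume)
          ((atom (θ j) (latticePoint n t j.1) (latticePoint n t' j.2)).toLp 2 volume)‖ ≤ C := by
  obtain ⟨C, hC, hCb⟩ := exists_norm_inner_atom_le hS (n + 1)
  have hw : Summable fun i : (Fin n → ℤ) × (Fin n → ℤ) =>
      (1 + ‖latticePoint n t i.1‖) ^ (-((n + 1 : ℕ) : ℝ)) *
        (1 + ‖latticePoint n t' i.2‖) ^ (-((n + 1 : ℕ) : ℝ)) :=
    (summable_one_add_norm_latticePoint ht (by simp)).mul_of_nonneg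
      (summable_one_add_norm_latticePoint ht' (by simp)) (fun _ => by positivity)
      (fun _ => by positivity)
  set w := fun i : (Fin n → ℤ) × (Fin n → ℤ) =>
      (1 + ‖latticePoint n t i.1‖) ^ (-((n + 1 : ℕ) : ℝ)) *
        (1 + ‖latticePoint n t' i.2‖) ^ (-((n + 1 : ℕ) : ℝ)) with hwdef
  have hw0 : ∀ i, 0 ≤ w i := fun i => by positivity
  refine ⟨C * ∑' i, w i, mul_nonneg hC (tsum_nonneg hw0), fun θ hθ i F => ?_⟩
  have h1 : ∀ j, ‖inner ℂ ((atom (θ i) (latticePoint n t i.1) (latticePoint n t' i.2)).toLp 2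
      volume) ((atom (θ j) (latticePoint n t j.1) (latticePoint n t' j.2)).toLp 2 volume)‖ ≤
      C * w (i - j) := by
    intro j
    have h := hCb (θ i) (hθ i) (θ j) (hθ j) (latticePoint n t i.1) (latticePoint n t' i.2)
      (latticePoint n t j.1) (latticePoint n t' j.2)
    simp only [hwdef, Prod.fst_sub, Prod.snd_sub, latticePoint_sub]
    rw [Real.rpow_neg (by positivity), Real.rpow_neg (by positivity), Real.rpow_natCast,
      Real.rpow_natCast, ← mul_inv, ← div_eq_mul_inv, le_div_iff₀ (by positivity), mul_comm]
    exact h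
  refine (Finset.sum_le_sum fun j _ => h1 j).trans ?_
  rw [← Finset.mul_sum]
  refine mul_le_mul_of_nonneg_left ?_ hC
  -- The bound depends only on i - j, so each row sum is part of the full lattice sum, independently
  -- of i.
  have hinj : Function.Injective fun j => i - j := sub_right_injective
  have := hw.comp_injective hinj
  exact (this.sum_le_tsum F fun j _ => hw0 _).trans
    (tsum_comp_le_tsum_of_inj hw hw0 hinj)

end AtomBessel

/-! ### Parseval's identity on a unit cube -/

section Parseval

attribute [local instance] instMeasureSpaceUnitAddCircle

variable {n : ℕ}

open UnitAddTorus

/-- The cube `∏ (aᵢ, aᵢ + 1]`. -/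
def unitCube (a : Fin n → ℝ) : Set (Fin n → ℝ) := {x | ∀ i, x i ∈ Set.Ioc (a i) (a i + 1)}

theorem mFourier_coe_eq_modulation (m : Fin n → ℤ) (x : EuclideanSpace ℝ (Fin n)) :
    mFourier m (fun i => (x i : UnitAddCircle)) = modulation (latticePoint n 1 m) x := by
  simp only [mFourier, ContinuousMap.coe_mk, fourier_coe_apply, modulation, latticePoint,
    ← Complex.exp_sum, PiLp.inner_apply]
  congr 1
  push_cast
  rw [Finset.mul_sum, Finset.sum_mul]
  refine Finset.sum_congr rfl fun i _ => ?_
  simp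
  ring

/-- The function on the torus obtained by periodizing the restriction of `F` to a unit cube. -/
noncomputable def toTorus (a : Fin n → ℝ) (F : EuclideanSpace ℝ (Fin n) → ℂ)
    (t : UnitAddTorus (Fin n)) : ℂ :=
  F (WithLp.toLp 2 fun i => (AddCircle.equivIoc 1 (a i) (t i) : ℝ))

theorem toTorus_coe {a x : Fin n → ℝ} (hx : x ∈ unitCube a) (F : EuclideanSpace ℝ (Fin n) → ℂ) :
    toTorus a F (fun i => (x i : UnitAddCircle)) = F (WithLp.toLp 2 x) := by
  simp only [toTorus]
  congr 2
  ext i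
  exact AddCircle.equivIoc_coe_of_mem (hx i)

theorem measurable_toTorus (a : Fin n → ℝ) {F : EuclideanSpace ℝ (Fin n) → ℂ}
    (hF : Measurable F) : Measurable (toTorus a F) := by
  refine hF.comp ((WithLp.measurable_toLp 2 _).comp (measurable_pi_lambda _ fun i => ?_))
  exact measurable_subtype_coe.comp
    ((AddCircle.measurableEquivIoc 1 (a i)).measurable.comp (measurable_pi_apply i))

theorem integral_torus_eq {a : Fin n → ℝ} {f : UnitAddTorus (Fin n) → ℂ}
    {F : EuclideanSpace ℝ (Fin n) → ℂ}
    (h : ∀ x ∈ unitCube a, f (fun i => (x i : UnitAddCircle)) = F (WithLp.toLp 2 x))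
    (hF : ∀ x : EuclideanSpace ℝ (Fin n), WithLp.ofLp x ∉ unitCube a → F x = 0) :
    ∫ t, f t = ∫ x, F x := by
  have hms : MeasurableSet (unitCube a) := by
    have : unitCube a = Set.pi Set.univ fun i => Set.Ioc (a i) (a i + 1) := by
      ext x
      simp [unitCube]
    rw [this]
    exact MeasurableSet.univ_pi fun i => measurableSet_Ioc
  rw [UnitAddTorus.integral_preimage f a]
  change ∫ x in unitCube a, f (fun i => (x i : UnitAddCircle)) = _
  rw [setIntegral_congr_fun hms h,
    setIntegral_eq_integral_of_forall_compl_eq_zero fun x hx => hF _ hx]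
  exact (PiLp.volume_preserving_toLp (Fin n)).integral_comp
    (MeasurableEquiv.toLp 2 (Fin n → ℝ)).measurableEmbedding F

/-- Functions vanishing off a unit cube are functions on the torus. Parseval there is sesquilinear,
so it is applied to the conjugate of F and G; the conjugation also turns the frequency -m of F into
m. -/
theorem hasSum_integral_modulation_mul {a : Fin n → ℝ} {F G : EuclideanSpace ℝ (Fin n) → ℂ}
    (hF : Continuous F) (hG : Continuous G) {C : ℝ} (hFC : ∀ x, ‖F x‖ ≤ C) (hGC : ∀ x, ‖G x‖ ≤ C)
    (hF0 : ∀ x : EuclideanSpace ℝ (Fin n), WithLp.ofLp x ∉ unitCube a → F x = 0)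
    (hG0 : ∀ x : EuclideanSpace ℝ (Fin n), WithLp.ofLp x ∉ unitCube a → G x = 0) :
    HasSum (fun m : Fin n → ℤ => (∫ x, modulation (latticePoint n 1 m) x * F x) *
      ∫ x, modulation (latticePoint n 1 (-m)) x * G x) (∫ x, F x * G x) := by
  have : IsProbabilityMeasure (volume : Measure UnitAddCircle) :=
    inferInstanceAs (IsProbabilityMeasure AddCircle.haarAddCircle)
  set F' : EuclideanSpace ℝ (Fin n) → ℂ := fun x => starRingEnd ℂ (F x) with hF'
  have hF'm : Measurable F' := (Complex.continuous_conj.comp hF).measurable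
  have mf : MemLp (toTorus a F') 2 (volume : Measure (UnitAddTorus (Fin n))) :=
    MemLp.of_bound (measurable_toTorus a hF'm).aestronglyMeasurable C
      (.of_forall fun t => by simpa [toTorus, hF'] using hFC _)
  have mg : MemLp (toTorus a G) 2 (volume : Measure (UnitAddTorus (Fin n))) :=
    MemLp.of_bound (measurable_toTorus a hG.measurable).aestronglyMeasurable C
      (.of_forall fun t => by simpa [toTorus] using hGC _)
  have coeff : ∀ {H : EuclideanSpace ℝ (Fin n) → ℂ}
      (mh : MemLp (toTorus a H) 2 (volume : Measure (UnitAddTorus (Fin n))))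
      (_ : ∀ x : EuclideanSpace ℝ (Fin n), WithLp.ofLp x ∉ unitCube a → H x = 0) (m : Fin n → ℤ),
      mFourierCoeff mh.toLp m = ∫ x, modulation (latticePoint n 1 (-m)) x * H x := by
    intro H mh h0 m
    rw [mFourierCoeff, integral_congr_ae (g := fun t => mFourier (-m) t • toTorus a H t)]
    · refine integral_torus_eq (a := a) (fun x hx => ?_) fun x hx => by rw [h0 x hx, mul_zero]
      rw [toTorus_coe hx, smul_eq_mul, ← mFourier_coe_eq_modulation]
    · filter_upwards [mh.coeFn_toLp] with t ht
      rw [ht]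
  have h := hasSum_prod_mFourierCoeff mf.toLp mg.toLp
  convert h using 1
  · ext m
    rw [coeff mf (fun x hx => by simp [hF', hF0 x hx]), coeff mg hG0, ← integral_conj]
    congr 2
    ext x
    rw [map_mul]
    simp only [hF', Complex.conj_conj]
    congr 1
    rw [← mFourier_coe_eq_modulation, ← mFourier_coe_eq_modulation, ← mFourier_neg, neg_neg]
  · rw [integral_congr_ae (g := fun t => starRingEnd ℂ (toTorus a F' t) * toTorus a G t)]
    · refine (integral_torus_eq (a := a) (fun x hx => ?_) fun x hx => by
        rw [hF0 x hx, zero_mul]).symm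
      rw [toTorus_coe hx, toTorus_coe hx]
      simp [hF']
    · filter_upwards [mf.coeFn_toLp, mg.coeFn_toLp] with t ht ht'
      rw [ht, ht']

end Parseval

/-! ### The partition of unity and the Gabor reproducing formula -/

section Windows

/-- A smooth bump on `ℝ` whose translates by half-integers sum to `1`. -/
noncomputable def lineWindow (t : ℝ) : ℝ :=
  Real.smoothTransition (4 * t) - Real.smoothTransition (4 * (t - 1 / 2))

/-- A smooth bump on `ℝ` equal to `1` on the support of `lineWindow`. -/
noncomputable def lineCutoff (t : ℝ) : ℝ :=
  Real.smoothTransition (8 * t + 1) * Real.smoothTransition (7 - 8 * t)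

theorem lineWindow_nonneg (t : ℝ) : 0 ≤ lineWindow t :=
  sub_nonneg.mpr (Real.smoothTransition.monotone (by linarith))

theorem lineWindow_eq_zero {t : ℝ} (h : t ∉ Set.Ioo (0 : ℝ) (3 / 4)) : lineWindow t = 0 := by
  rw [Set.mem_Ioo, not_and_or, not_lt, not_lt] at h
  rcases h with h | h
  · rw [lineWindow, Real.smoothTransition.zero_of_nonpos (by linarith),
      Real.smoothTransition.zero_of_nonpos (by linarith), sub_zero]
  · rw [lineWindow, Real.smoothTransition.one_of_one_le (by linarith),
      Real.smoothTransition.one_of_one_le (by linarith), sub_self]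

/-- The interval has length 1, so both windows fit into one unit cube and integer frequencies
suffice. -/
theorem lineCutoff_eq_zero {t : ℝ} (h : t ∉ Set.Ioo (-1 / 8 : ℝ) (7 / 8)) :
    lineCutoff t = 0 := by
  rw [Set.mem_Ioo, not_and_or, not_lt, not_lt] at h
  rcases h with h | h
  · rw [lineCutoff, Real.smoothTransition.zero_of_nonpos (by linarith), zero_mul]
  · rw [lineCutoff, Real.smoothTransition.zero_of_nonpos (x := 7 - 8 * t) (by linarith), mul_zero]

theorem lineWindow_mul_lineCutoff (t : ℝ) : lineWindow t * lineCutoff t = lineWindow t := by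
  by_cases h : t ∈ Set.Ioo (0 : ℝ) (3 / 4)
  · rw [lineCutoff, Real.smoothTransition.one_of_one_le (by linarith [h.1]),
      Real.smoothTransition.one_of_one_le (by linarith [h.2]), mul_one, mul_one]
  · rw [lineWindow_eq_zero h, zero_mul]

theorem contDiff_lineWindow : ContDiff ℝ (↑(⊤ : ℕ∞)) lineWindow :=
  (Real.smoothTransition.contDiff.comp (contDiff_const.mul contDiff_id)).sub
    (Real.smoothTransition.contDiff.comp (contDiff_const.mul (contDiff_id.sub contDiff_const)))

theorem contDiff_lineCutoff : ContDiff ℝ (↑(⊤ : ℕ∞)) lineCutoff :=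
  (Real.smoothTransition.contDiff.comp
    ((contDiff_const.mul contDiff_id).add contDiff_const)).mul
    (Real.smoothTransition.contDiff.comp (contDiff_const.sub (contDiff_const.mul contDiff_id)))

/-- The two half-integer translates of `lineWindow` that can be nonzero at `t`. -/
noncomputable def activeTranslates (t : ℝ) : Finset ℤ := {⌊2 * t⌋, ⌊2 * t⌋ - 1}

theorem lineWindow_sub_eq_zero {t : ℝ} {k : ℤ} (hk : k ∉ activeTranslates t) :
    lineWindow (t - 1 / 2 * k) = 0 := by
  refine lineWindow_eq_zero fun h => hk ?_
  rw [activeTranslates, Finset.mem_insert, Finset.mem_singleton]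
  have h1 := Int.floor_le (2 * t)
  have h2 := Int.lt_floor_add_one (2 * t)
  have h3 : (k : ℝ) < ⌊2 * t⌋ + 1 := by linarith [h.1]
  have h4 : (⌊2 * t⌋ : ℝ) - 2 < k := by linarith [h.2]
  have h5 : k < ⌊2 * t⌋ + 1 := by exact_mod_cast h3
  have h6 : ⌊2 * t⌋ - 2 < k := by exact_mod_cast h4
  omega

/-- The sum telescopes: the middle transition cancels, the first has reached 1 and the last is still
0. -/
theorem sum_lineWindow (t : ℝ) : ∑ k ∈ activeTranslates t, lineWindow (t - 1 / 2 * k) = 1 := by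
  have h1 := Int.floor_le (2 * t)
  have h2 := Int.lt_floor_add_one (2 * t)
  rw [activeTranslates, Finset.sum_pair (by omega)]
  simp only [lineWindow]
  push_cast
  rw [Real.smoothTransition.one_of_one_le (x := 4 * (t - 1 / 2 * ((⌊2 * t⌋ : ℝ) - 1)))
      (by linarith),
    Real.smoothTransition.zero_of_nonpos (x := 4 * (t - 1 / 2 * (⌊2 * t⌋ : ℝ) - 1 / 2))
      (by linarith),
    show t - 1 / 2 * ((⌊2 * t⌋ : ℝ) - 1) - 1 / 2 = t - 1 / 2 * (⌊2 * t⌋ : ℝ) by ring]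
  ring

variable {n : ℕ}

/-- The tensor power of a function on the line. -/
noncomputable def tensorPow (n : ℕ) (g : ℝ → ℝ) (x : EuclideanSpace ℝ (Fin n)) : ℂ :=
  ((∏ i, g (x i) : ℝ) : ℂ)

theorem contDiff_tensorPow {g : ℝ → ℝ} (hg : ContDiff ℝ (↑(⊤ : ℕ∞)) g) :
    ContDiff ℝ (↑(⊤ : ℕ∞)) (tensorPow n g) := by
  have h : ContDiff ℝ (↑(⊤ : ℕ∞)) fun x : EuclideanSpace ℝ (Fin n) => ∏ i, g (x i) :=
    contDiff_prod fun i _ => hg.comp (EuclideanSpace.proj (𝕜 := ℝ) i).contDiff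
  exact Complex.ofRealCLM.contDiff.comp h

theorem hasCompactSupport_tensorPow {g : ℝ → ℝ} (hg : ∀ t, 1 < |t| → g t = 0) :
    HasCompactSupport (tensorPow n g) := by
  refine HasCompactSupport.of_support_subset_isCompact
    (isCompact_closedBall (0 : EuclideanSpace ℝ (Fin n)) (√n)) fun x hx => ?_
  have h : ∀ i, |x i| ≤ 1 := by
    intro i
    by_contra hi
    refine hx ?_
    rw [tensorPow, Finset.prod_eq_zero (Finset.mem_univ i) (hg _ (not_le.mp hi)),
      Complex.ofReal_zero]
  rw [mem_closedBall_zero_iff, EuclideanSpace.norm_eq]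
  refine Real.sqrt_le_sqrt ?_
  refine (Finset.sum_le_card_nsmul Finset.univ _ 1 fun i _ => ?_).trans (by simp)
  rw [Real.norm_eq_abs]
  exact pow_le_one₀ (abs_nonneg _) (h i)

/-- The analysis window: its translates by `½ ℤⁿ` form a partition of unity. -/
noncomputable def window (n : ℕ) : 𝓢(EuclideanSpace ℝ (Fin n), ℂ) :=
  (hasCompactSupport_tensorPow (n := n) (g := lineWindow) fun t ht => lineWindow_eq_zero fun h => by
    rw [abs_of_pos h.1] at ht; linarith [h.2]).toSchwartzMap (contDiff_tensorPow contDiff_lineWindow)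

/-- The synthesis window. -/
noncomputable def cutoff (n : ℕ) : 𝓢(EuclideanSpace ℝ (Fin n), ℂ) :=
  (hasCompactSupport_tensorPow (n := n) (g := lineCutoff) fun t ht => lineCutoff_eq_zero fun h => by
    have : |t| ≤ 1 := abs_le.mpr ⟨by linarith [h.1], by linarith [h.2]⟩
    linarith).toSchwartzMap (contDiff_tensorPow contDiff_lineCutoff)

theorem window_apply (x : EuclideanSpace ℝ (Fin n)) : window n x = tensorPow n lineWindow x := rfl

theorem cutoff_apply (x : EuclideanSpace ℝ (Fin n)) : cutoff n x = tensorPow n lineCutoff x := rfl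

theorem window_mul_cutoff (x : EuclideanSpace ℝ (Fin n)) : window n x * cutoff n x = window n x := by
  rw [window_apply, cutoff_apply, tensorPow, tensorPow, ← Complex.ofReal_mul,
    ← Finset.prod_mul_distrib]
  simp only [lineWindow_mul_lineCutoff]

theorem window_sub_latticePoint (x : EuclideanSpace ℝ (Fin n)) (k : Fin n → ℤ) :
    window n (x - latticePoint n (1 / 2) k) =
      ((∏ i, lineWindow (x i - 1 / 2 * k i) : ℝ) : ℂ) := rfl

theorem hasSum_window (x : EuclideanSpace ℝ (Fin n)) :
    HasSum (fun k : Fin n → ℤ => ∏ i, lineWindow (x i - 1 / 2 * k i)) 1 := by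
  have h : ∑ k ∈ Fintype.piFinset fun i => activeTranslates (x i),
      ∏ i, lineWindow (x i - 1 / 2 * k i) = 1 := by
    rw [← Finset.prod_univ_sum (fun i => activeTranslates (x i))
      fun i (k : ℤ) => lineWindow (x i - 1 / 2 * k)]
    exact Finset.prod_eq_one fun i _ => sum_lineWindow (x i)
  suffices H : ∀ k ∉ Fintype.piFinset fun i => activeTranslates (x i),
      ∏ i, lineWindow (x i - 1 / 2 * k i) = 0 by
    have hs := hasSum_sum_of_ne_finset_zero (L := .unconditional _) H
    rwa [h] at hs
  intro k hk
  rw [Fintype.mem_piFinset, not_forall] at hk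
  obtain ⟨i, hi⟩ := hk
  exact Finset.prod_eq_zero (Finset.mem_univ i) (lineWindow_sub_eq_zero hi)

theorem hasSum_integral_window_mul (f : EuclideanSpace ℝ (Fin n) → ℂ) (hf : Integrable f) :
    HasSum (fun k : Fin n → ℤ => ∫ x, window n (x - latticePoint n (1 / 2) k) * f x)
      (∫ x, f x) := by
  have hw : ∀ x : EuclideanSpace ℝ (Fin n), HasSum (fun k : Fin n → ℤ =>
      (∏ i, lineWindow (x i - 1 / 2 * k i)) * ‖f x‖) ‖f x‖ := fun x => by
    simpa using (hasSum_window x).mul_right ‖f x‖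
  refine hasSum_integral_of_dominated_convergence
    (fun k x => (∏ i, lineWindow (x i - 1 / 2 * k i)) * ‖f x‖) (fun k => ?_) (fun k => ?_)
    (.of_forall fun x => (hw x).summable) ?_ (.of_forall fun x => ?_)
  · exact ((window n).continuous.comp (continuous_id.sub continuous_const)).aestronglyMeasurable.mul
      hf.aestronglyMeasurable
  · refine .of_forall fun x => ?_
    rw [window_sub_latticePoint, norm_mul, Complex.norm_real, Real.norm_of_nonneg
      (Finset.prod_nonneg fun i _ => lineWindow_nonneg _)]
  · simp only [(hw _).tsum_eq]
    exact hf.norm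
  · simp only [window_sub_latticePoint]
    simpa using ((Complex.hasSum_ofReal.mpr (hasSum_window x)).mul_right (f x))

/-- The Gabor reproducing formula. -/
theorem tsum_integral_atom_mul (ψ φ : 𝓢(EuclideanSpace ℝ (Fin n), ℂ))
    (hs : Summable fun i : (Fin n → ℤ) × (Fin n → ℤ) =>
      (∫ x, atom (window n) (latticePoint n (1 / 2) i.1) (latticePoint n 1 i.2) x * ψ x) *
        ∫ x, atom (cutoff n) (latticePoint n (1 / 2) i.1) (latticePoint n (-1) i.2) x * φ x) :
    ∑' i : (Fin n → ℤ) × (Fin n → ℤ),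
      (∫ x, atom (window n) (latticePoint n (1 / 2) i.1) (latticePoint n 1 i.2) x * ψ x) *
        (∫ x, atom (cutoff n) (latticePoint n (1 / 2) i.1) (latticePoint n (-1) i.2) x * φ x) =
      ∫ x, ψ x * φ x := by
  have hneg : ∀ m : Fin n → ℤ, latticePoint n (-1) m = latticePoint n 1 (-m) := by
    intro m
    ext i
    simp [latticePoint]
  -- For fixed k the sum over frequencies is Parseval on the cube with corner κ - 1/8, which carries
  -- both windows; their product is `window` again. Summing over k then uses the partition of unity.
  have hfib : ∀ k : Fin n → ℤ, HasSum (fun m : Fin n → ℤ =>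
      (∫ x, atom (window n) (latticePoint n (1 / 2) k) (latticePoint n 1 m) x * ψ x) *
        ∫ x, atom (cutoff n) (latticePoint n (1 / 2) k) (latticePoint n (-1) m) x * φ x)
      (∫ x, window n (x - latticePoint n (1 / 2) k) * (ψ x * φ x)) := by
    intro k
    set κ := latticePoint n (1 / 2) k
    have hsupp : ∀ (g : ℝ → ℝ) (_ : ∀ t, t ∉ Set.Ioo (-1 / 8 : ℝ) (7 / 8) → g t = 0)
        (x : EuclideanSpace ℝ (Fin n)), WithLp.ofLp x ∉ unitCube (fun i => κ i - 1 / 8) →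
        tensorPow n g (x - κ) = 0 := by
      intro g hg x hx
      simp only [unitCube, Set.mem_ofPred_eq, not_forall] at hx
      obtain ⟨i, hi⟩ := hx
      have hz : g ((x - κ) i) = 0 := hg _ fun h => by
        rw [PiLp.sub_apply] at h
        exact hi ⟨by linarith [h.1], by linarith [h.2]⟩
      rw [tensorPow, Finset.prod_eq_zero (Finset.mem_univ i) hz, Complex.ofReal_zero]
    have hbdd : ∀ (η θ : 𝓢(EuclideanSpace ℝ (Fin n), ℂ)) (x : EuclideanSpace ℝ (Fin n)),
        ‖η (x - κ) * θ x‖ ≤ SchwartzMap.seminorm ℂ 0 0 η * SchwartzMap.seminorm ℂ 0 0 θ := by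
      intro η θ x
      rw [norm_mul]
      gcongr
      · exact SchwartzMap.norm_le_seminorm ℂ η _
      · exact SchwartzMap.norm_le_seminorm ℂ θ _
    have hcont : ∀ η θ : 𝓢(EuclideanSpace ℝ (Fin n), ℂ),
        Continuous fun x => η (x - κ) * θ x := fun η θ =>
      (η.continuous.comp (continuous_id.sub continuous_const)).mul θ.continuous
    have h := hasSum_integral_modulation_mul (a := fun i => κ i - 1 / 8) (hcont (window n) ψ)
      (hcont (cutoff n) φ) (fun x => (hbdd _ _ x).trans (le_max_left _ _))
      (fun x => (hbdd _ _ x).trans (le_max_right _ _))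
      (fun x hx => by
        rw [window_apply, hsupp lineWindow (fun t ht => lineWindow_eq_zero fun h => ht
          ⟨by linarith [h.1], by linarith [h.2]⟩) x hx, zero_mul])
      (fun x hx => by
        rw [cutoff_apply, hsupp lineCutoff (fun t ht => lineCutoff_eq_zero ht) x hx, zero_mul])
    convert h using 1
    · simp only [atom_apply, mul_assoc, hneg]
    · congr 1
      ext x
      linear_combination (-(ψ x * φ x)) * window_mul_cutoff (x - κ)
  have hi : Integrable fun x => ψ x * φ x :=
    (SchwartzMap.pairing (ContinuousLinearMap.mul ℂ ℂ) ψ φ).integrable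
  exact (hs.hasSum.prod_fiberwise hfib).unique (hasSum_integral_window_mul _ hi)

end Windows

/-! ### The diagonal expansion of the embedding -/

section Assembly

open FourierTransform

variable {n : ℕ}

local notation "E" => EuclideanSpace ℝ (Fin n)

/-- For the bilinear pairing the transpose of `besselWeight n s δ` is ⟨x⟩^{-δ} ⟨D⟩^{-s}, which
inverts ⟨D⟩^s ⟨x⟩^δ. The symbols are even, so transposing the Fourier multiplier does not change it.
-/
theorem integral_besselWeight_mul (s δ : ℝ) (φ ψ : 𝓢(E, ℂ)) :
    ∫ x, besselWeight n s δ φ x * besselWeight n (-s) (-δ) ψ x = ∫ x, φ x * ψ x := by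
  simp only [besselWeight, neg_neg]
  set a := SchwartzMap.smulLeftCLM ℂ (bracketPow n (-δ)) φ with ha
  set b := SchwartzMap.smulLeftCLM ℂ (bracketPow n δ) ψ with hb
  set q := SchwartzMap.smulLeftCLM ℂ (bracketPow n s) (𝓕⁻ b) with hq
  have hinv : ∀ (g : 𝓢(E, ℂ)) (ξ : E), 𝓕⁻ g ξ = 𝓕 g (-ξ) := fun g ξ => rfl
  have hqq : ∀ ξ : E, 𝓕 (𝓕 q) ξ = bracketPow n s ξ * 𝓕 b ξ := by
    intro ξ
    have h := hinv (𝓕 q) (-ξ)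
    rw [FourierTransform.fourierInv_fourier_eq, neg_neg] at h
    rw [← h, hq, SchwartzMap.smulLeftCLM_apply_apply (bracketPow_hasTemperateGrowth n s),
      smul_eq_mul, bracketPow_neg_arg, hinv, neg_neg]
  rw [SchwartzMap.integral_fourier_mul_eq]
  calc _ = ∫ ξ, 𝓕⁻ a ξ * 𝓕 b ξ := by
        refine integral_congr_ae (.of_forall fun ξ => ?_)
        simp only [hqq, SchwartzMap.smulLeftCLM_apply_apply (bracketPow_hasTemperateGrowth n (-s)),
          smul_eq_mul]
        linear_combination (𝓕⁻ a ξ * 𝓕 b ξ) * bracketPow_mul_neg s ξ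
    _ = ∫ x, a x * b x := by
        rw [SchwartzMap.integral_fourierInv_mul_eq, FourierTransform.fourierInv_fourier_eq]
    _ = _ := by
        refine integral_congr_ae (.of_forall fun x => ?_)
        simp only [ha, hb, SchwartzMap.smulLeftCLM_apply_apply (bracketPow_hasTemperateGrowth n _),
          smul_eq_mul]
        linear_combination (φ x * ψ x) * bracketPow_mul_neg δ x

theorem smulLeftCLM_bracketPow_neg_cancel (r : ℝ) (φ : 𝓢(E, ℂ)) :
    SchwartzMap.smulLeftCLM ℂ (bracketPow n r)
      (SchwartzMap.smulLeftCLM ℂ (bracketPow n (-r)) φ) = φ := by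
  ext x
  rw [SchwartzMap.smulLeftCLM_apply_apply (bracketPow_hasTemperateGrowth n _),
    SchwartzMap.smulLeftCLM_apply_apply (bracketPow_hasTemperateGrowth n _), smul_eq_mul,
    smul_eq_mul, ← mul_assoc, bracketPow_mul_neg, one_mul]

theorem besselWeight_surjective (s δ : ℝ) :
    Function.Surjective (besselWeight n s δ) := by
  intro h
  refine ⟨SchwartzMap.smulLeftCLM ℂ (bracketPow n δ)
    (𝓕 (SchwartzMap.smulLeftCLM ℂ (bracketPow n s) (𝓕⁻ h))), ?_⟩
  have h1 := smulLeftCLM_bracketPow_neg_cancel (n := n) (-δ)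
    (𝓕 (SchwartzMap.smulLeftCLM ℂ (bracketPow n s) (𝓕⁻ h)))
  have h2 := smulLeftCLM_bracketPow_neg_cancel (n := n) (-s) (𝓕⁻ h)
  rw [neg_neg] at h1 h2
  rw [besselWeight, h1, FourierTransform.fourierInv_fourier_eq, h2,
    FourierTransform.fourier_fourierInv_eq]

theorem mulBracket_apply (r : ℝ) (u : 𝓢'(E, ℂ)) (φ : 𝓢(E, ℂ)) :
    mulBracket n r u φ = u (SchwartzMap.smulLeftCLM ℂ (bracketPow n r) φ) := rfl

theorem besselPotential_apply (r : ℝ) (u : 𝓢'(E, ℂ)) (φ : 𝓢(E, ℂ)) :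
    TemperedDistribution.besselPotential E ℂ r u φ =
      u (𝓕 (SchwartzMap.smulLeftCLM ℂ (bracketPow n r) (𝓕⁻ φ))) := rfl

theorem WeightedSobolev.toDistribution_apply {s δ : ℝ} (u : WeightedSobolev n s δ)
    (φ : 𝓢(E, ℂ)) :
    u.toDistribution φ = ∫ x, besselWeight n s δ φ x * toL2 u x := by
  have h := congrArg (TemperedDistribution.besselPotential E ℂ (-s)) (toL2_spec u)
  simp only [TemperedDistribution.besselPotential_besselPotential_apply, add_neg_cancel,
    TemperedDistribution.besselPotential_zero, ContinuousLinearMap.id_apply] at h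
  have h2 := congrArg (mulBracket n (-δ)) h
  rw [mulBracket_mulBracket, add_neg_cancel, mulBracket_zero] at h2
  rw [h2, mulBracket_apply, besselPotential_apply, Lp.toTemperedDistribution_apply]
  rfl

theorem inner_star_toLp (h : 𝓢(E, ℂ)) (f : Lp ℂ 2 (volume : Measure E)) :
    inner ℂ (star (h.toLp 2 volume)) f = ∫ x, h x * f x := by
  rw [L2.inner_def]
  refine integral_congr_ae ?_
  filter_upwards [Lp.coeFn_star (h.toLp 2 volume), h.coeFn_toLp 2 volume] with x h1 h2
  rw [h1, Pi.star_apply, h2, RCLike.inner_apply, RCLike.star_def, RCLike.conj_conj, mul_comm]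

theorem inner_star_toLp_toLp (h g : 𝓢(E, ℂ)) :
    inner ℂ (star (h.toLp 2 volume)) (g.toLp 2 volume) = ∫ x, h x * g x := by
  rw [inner_star_toLp]
  refine integral_congr_ae ?_
  filter_upwards [g.coeFn_toLp 2 volume] with x h1
  rw [h1]

theorem norm_inner_star_star (f g : Lp ℂ 2 (volume : Measure E)) :
    ‖inner ℂ (star f) (star g)‖ = ‖inner ℂ f g‖ := by
  have h : inner ℂ (star f) (star g) = starRingEnd ℂ (inner ℂ f g) := by
    rw [L2.inner_def, L2.inner_def, ← integral_conj]
    refine integral_congr_ae ?_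
    filter_upwards [Lp.coeFn_star f, Lp.coeFn_star g] with x h1 h2
    rw [h1, h2, Pi.star_apply, Pi.star_apply, RCLike.inner_apply, RCLike.inner_apply, map_mul]
    rfl
  rw [h, RCLike.norm_conj]

/-- The singular values of the diagonal model of the embedding. -/
noncomputable def gaborWeight (n : ℕ) (a b : ℝ) (i : (Fin n → ℤ) × (Fin n → ℤ)) : ℝ :=
  (1 + ‖latticePoint n (1 / 2) i.1‖ ^ 2) ^ (-a / 2) * (1 + ‖latticePoint n 1 i.2‖ ^ 2) ^ (-b / 2)

theorem gaborWeight_nonneg (a b : ℝ) (i : (Fin n → ℤ) × (Fin n → ℤ)) :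
    0 ≤ gaborWeight n a b i := by
  unfold gaborWeight
  positivity

theorem summable_gaborWeight_rpow {a b q : ℝ} (hq : 0 < q) (ha : n / q < a) (hb : n / q < b) :
    Summable fun i => gaborWeight n a b i ^ q := by
  have key : ∀ {t : ℝ} (_ : t ≠ 0) {c : ℝ} (_ : n / q < c), Summable fun k : Fin n → ℤ =>
      ((1 + ‖latticePoint n t k‖ ^ 2) ^ (-c / 2)) ^ q := by
    intro t ht c hc
    have hcq : n < c * q := (div_lt_iff₀ hq).mp hc
    refine Summable.of_nonneg_of_le (fun k => by positivity) (fun k => ?_)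
      ((summable_one_add_norm_latticePoint ht hcq).mul_left (2 ^ (c * q / 2)))
    rw [← Real.rpow_mul (by positivity), show -c / 2 * q = -(c * q) / 2 by ring]
    exact rpow_neg_one_add_norm_sq_le _ ((Nat.cast_nonneg n).trans_lt hcq)
  refine ((key (by norm_num : (1 / 2 : ℝ) ≠ 0) ha).mul_of_nonneg (key one_ne_zero hb)
    (fun _ => by positivity) (fun _ => by positivity)).congr fun i => ?_
  rw [gaborWeight, Real.mul_rpow (by positivity) (by positivity)]

theorem tendsto_cofinite_of_summable_rpow {ι : Type*} {l : ι → ℝ} (hl : ∀ i, 0 ≤ l i) {q : ℝ}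
    (hq : 0 < q) (hs : Summable fun i => l i ^ q) :
    Filter.Tendsto l Filter.cofinite (nhds 0) := by
  have h := hs.tendsto_cofinite_zero.rpow_const (p := 1 / q) (Or.inr (by positivity))
  rw [Real.zero_rpow (by positivity)] at h
  refine h.congr fun i => ?_
  rw [← Real.rpow_mul (hl i), mul_one_div_cancel hq.ne', Real.rpow_one]

/-- These are the two scalars from `besselWeight_atom`: for (s, δ) at frequency μ and for (-s', -δ')
at frequency -μ. -/
theorem gaborWeight_eq (s s' δ δ' : ℝ) (i : (Fin n → ℤ) × (Fin n → ℤ)) :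
    (gaborWeight n (δ - δ') (s - s') i : ℂ) =
      (bracketPow n (-δ) (latticePoint n (1 / 2) i.1) * bracketPow n (-s) (latticePoint n 1 i.2)) *
      (bracketPow n (-(-δ')) (latticePoint n (1 / 2) i.1) *
        bracketPow n (-(-s')) (latticePoint n (-1) i.2)) := by
  have hneg : latticePoint n (-1) i.2 = -latticePoint n 1 i.2 := by
    ext j
    simp [latticePoint]
  rw [hneg, bracketPow_neg_arg]
  simp only [bracketPow, gaborWeight, ← Complex.ofReal_mul]
  congr 1
  rw [show -(δ - δ') / 2 = -δ / 2 + - -δ' / 2 by ring,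
    show -(s - s') / 2 = -s / 2 + - -s' / 2 by ring,
    Real.rpow_add (by positivity), Real.rpow_add (by positivity)]
  ring

/-- The identity says that ⟨x⟩^{-δ'} ⟨D⟩^{-s'} A f and ⟨x⟩^{-δ} ⟨D⟩^{-s} f are the same
distribution, so A is the embedding seen on L². -/
theorem exists_schatten_operator (n : ℕ) (p : ℝ) (hp : 0 < p) (s s' δ δ' : ℝ)
    (hδ : δ > δ' + n / p) (hs : s > s' + n / p) :
    ∃ A : Lp ℂ 2 (volume : Measure (EuclideanSpace ℝ (Fin n))) →L[ℂ]
        Lp ℂ 2 (volume : Measure (EuclideanSpace ℝ (Fin n))),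
      MemSchatten p A ∧ ∀ (f : Lp ℂ 2 (volume : Measure (EuclideanSpace ℝ (Fin n))))
        (φ : 𝓢(EuclideanSpace ℝ (Fin n), ℂ)),
        ∫ x, besselWeight n s' δ' φ x * A f x = ∫ x, besselWeight n s δ φ x * f x := by
  have hnp : 0 ≤ n / p := by positivity
  have ha : 0 < δ - δ' := by linarith
  have hb : 0 < s - s' := by linarith
  -- Strictness of the hypotheses leaves room below p; the 0 in the maximum keeps q positive when n
  -- = 0.
  obtain ⟨q, hq1, hqp⟩ : ∃ q, max (max (n / (δ - δ')) (n / (s - s'))) 0 < q ∧ q < p := by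
    refine exists_between (max_lt (max_lt ?_ ?_) hp)
    · rw [div_lt_iff₀ ha, mul_comm, ← div_lt_iff₀ hp]
      linarith
    · rw [div_lt_iff₀ hb, mul_comm, ← div_lt_iff₀ hp]
      linarith
  obtain ⟨hq2, hq⟩ := max_lt_iff.mp hq1
  obtain ⟨hqa, hqb⟩ := max_lt_iff.mp hq2
  rw [div_lt_iff₀ ha, mul_comm, ← div_lt_iff₀ hq] at hqa
  rw [div_lt_iff₀ hb, mul_comm, ← div_lt_iff₀ hq] at hqb
  have hl0 := gaborWeight_nonneg (n := n) (δ - δ') (s - s')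
  have hsum := summable_gaborWeight_rpow hq hqa hqb
  have hlim := tendsto_cofinite_of_summable_rpow hl0 hq hsum
  set α : (Fin n → ℤ) × (Fin n → ℤ) → 𝓢(EuclideanSpace ℝ (Fin n), ℂ) := fun i =>
    atom (shiftedWindow n s δ (window n) (latticePoint n (1 / 2) i.1) (latticePoint n 1 i.2))
      (latticePoint n (1 / 2) i.1) (latticePoint n 1 i.2) with hα
  set β : (Fin n → ℤ) × (Fin n → ℤ) → 𝓢(EuclideanSpace ℝ (Fin n), ℂ) := fun i =>
    atom (shiftedWindow n (-s') (-δ') (cutoff n) (latticePoint n (1 / 2) i.1)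
      (latticePoint n (-1) i.2)) (latticePoint n (1 / 2) i.1) (latticePoint n (-1) i.2) with hβ
  set e := fun i => star ((α i).toLp 2 volume) with he
  set e' := fun i => (β i).toLp 2 volume with he'
  obtain ⟨C, hC, hCb⟩ := exists_sum_norm_inner_atom_le
    (isVonNBounded_shiftedWindow s δ (window n)) (by norm_num : (1 / 2 : ℝ) ≠ 0) one_ne_zero
  obtain ⟨C', hC', hCb'⟩ := exists_sum_norm_inner_atom_le
    (isVonNBounded_shiftedWindow (-s') (-δ') (cutoff n)) (by norm_num : (1 / 2 : ℝ) ≠ 0)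
    (by norm_num : (-1 : ℝ) ≠ 0)
  have hB : IsBesselSeq e C := isBesselSeq_of_gram hC fun i F => by
    simp only [he, norm_inner_star_star]
    exact hCb (fun i => shiftedWindow n s δ (window n) (latticePoint n (1 / 2) i.1)
      (latticePoint n 1 i.2)) (fun i => ⟨_, _, rfl⟩) i F
  have hB' : IsBesselSeq e' C' := isBesselSeq_of_gram hC' fun i F =>
    hCb' (fun i => shiftedWindow n (-s') (-δ') (cutoff n) (latticePoint n (1 / 2) i.1)
      (latticePoint n (-1) i.2)) (fun i => ⟨_, _, rfl⟩) i F
  refine ⟨∑' i, rankOneSMul (gaborWeight n (δ - δ') (s - s') i) (e i) (e' i),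
    memSchatten_tsum_rankOneSMul hB hB' hl0 hq hqp hsum hlim, fun f φ => ?_⟩
  have hA := (summable_rankOneSMul hB hB' hl0 hlim).hasSum
  set A := ∑' i, rankOneSMul (gaborWeight n (δ - δ') (s - s') i) (e i) (e' i)
  rw [← inner_star_toLp, ← inner_star_toLp]
  revert f
  -- Both sides are continuous in f, so Schwartz f suffice; writing f = `besselWeight n (-s) (-δ) ψ`
  -- turns the claim into the reproducing formula for ψ and φ.
  refine fun f => congrFun (DenseRange.equalizer
    (SchwartzMap.denseRange_toLpCLM (F := ℂ) (p := 2)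
      (μ := (volume : Measure (EuclideanSpace ℝ (Fin n)))) (by simp))
    (g := fun f => inner ℂ (star ((besselWeight n s' δ' φ).toLp 2 volume)) (A f))
    (h := fun f => inner ℂ (star ((besselWeight n s δ φ).toLp 2 volume)) f)
    (by fun_prop) (by fun_prop) (funext fun h => ?_)) f
  obtain ⟨ψ, rfl⟩ := besselWeight_surjective (-s) (-δ) h
  simp only [Function.comp_apply, SchwartzMap.toLpCLM_apply]
  rw [inner_star_toLp_toLp, integral_besselWeight_mul]
  have hterm : ∀ i, inner ℂ (star ((besselWeight n s' δ' φ).toLp 2 volume))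
      (rankOneSMul (gaborWeight n (δ - δ') (s - s') i) (e i) (e' i) ((besselWeight n (-s) (-δ) ψ).toLp 2 volume)) =
      (∫ x, atom (window n) (latticePoint n (1 / 2) i.1) (latticePoint n 1 i.2) x * ψ x) *
        ∫ x, atom (cutoff n) (latticePoint n (1 / 2) i.1) (latticePoint n (-1) i.2) x * φ x := by
    intro i
    have h1 := integral_besselWeight_mul s δ
      (atom (window n) (latticePoint n (1 / 2) i.1) (latticePoint n 1 i.2)) ψ
    have h2 := integral_besselWeight_mul (-s') (-δ')
      (atom (cutoff n) (latticePoint n (1 / 2) i.1) (latticePoint n (-1) i.2)) φ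
    rw [besselWeight_atom] at h1 h2
    rw [← h1, ← h2, rankOneSMul_apply, inner_smul_right, inner_star_toLp_toLp,
      inner_star_toLp_toLp, gaborWeight_eq]
    simp only [neg_neg, _root_.smul_apply, smul_eq_mul, mul_assoc, integral_const_mul]
    simp only [hα, hβ, mul_comm (besselWeight n s' δ' φ _)]
    ring
  -- Norm convergence of the operator series supplies the double summability required by the
  -- reproducing formula.
  have hH := ((hA.mapL (ContinuousLinearMap.apply ℂ _
    ((besselWeight n (-s) (-δ) ψ).toLp 2 volume))).mapL
      (innerSL ℂ (star ((besselWeight n s' δ' φ).toLp 2 volume))))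
  simp only [ContinuousLinearMap.apply_apply, innerSL_apply_apply, hterm] at hH
  rw [← hH.tsum_eq, tsum_integral_atom_mul ψ φ hH.summable]
  simp only [mul_comm]

end Assembly

theorem lemma3p2 (n : ℕ) (p : ℝ) (hp : 0 < p) (s s' δ δ' : ℝ)
    (hδ : δ > δ' + n / p) (hs : s > s' + n / p) :
    ∃ ι : WeightedSobolev n s δ →L[ℂ] WeightedSobolev n s' δ',
      (∀ u : WeightedSobolev n s δ, (ι u).toDistribution = u.toDistribution) ∧
        MemSchatten p ι := by
  obtain ⟨A, hA, hAf⟩ := exists_schatten_operator n p hp s s' δ δ' hδ hs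
  -- The embedding is A conjugated by the two isometries; the Schatten proof determines this
  -- witness.
  refine ⟨_, fun u => ?_, hA.comp_isometry hp.le WeightedSobolev.toL2Isometry
    (WeightedSobolev.toL2Isometry (s := s') (δ := δ')).symm⟩
  ext φ
  rw [WeightedSobolev.toDistribution_apply, WeightedSobolev.toDistribution_apply, ← hAf]
  have h : WeightedSobolev.toL2 ((WeightedSobolev.toL2Isometry (s := s') (δ := δ')).symm
      (A (WeightedSobolev.toL2 u))) = A (WeightedSobolev.toL2 u) :=
    (WeightedSobolev.toL2Isometry (s := s') (δ := δ')).apply_symm_apply _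
  change ∫ x, _ * (WeightedSobolev.toL2 ((WeightedSobolev.toL2Isometry (s := s') (δ := δ')).symm
      (A (WeightedSobolev.toL2 u)))) x = _
  rw [h]
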